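/- All groups are finite, classes of groups are closed under isomorphism, and $\mathfrak{J}$ is any class of non-abelian simple groups. A formation is a class of groups closed under homomorphic images that contains $G/(M\cap N)$ whenever $M,N\trianglelefteq G$ and it contains $G/M$ and $G/N$. A formation $\mathfrak{X}$ is solubly saturated if $G\in\mathfrak{X}$ whenever $G/\Phi(N)\in\mathfrak{X}$ for some soluble normal subgroup $N$ of $G$ (where $\Phi(N)$ is the Frattini subgroup of $N$); it is normally hereditary if it contains every normal subgroup of each of its members; it is Fitting if it is normally hereditary and $G\in\mathfrak{X}$ whenever $G=AB$ with $A,B\trianglelefteq G$ and $A,B\in\mathfrak{X}$. For a class $\mathfrak{X}$ of groups, let $\mathfrak{X}_{\mathfrak{J}cs}$ be the class of all groups $G$ such that every chief factor $H/K$ of $G$ with $H/K\in\mathfrak{X}$ satisfies $(H/K)\rtimes G/C_G(H/K)\in\mathfrak{X}$, and every other chief factor of $G$ is a simple group belonging to $\mathfrak{J}$. **Theorem.** Let $\mathfrak{F}$ be a formation containing all nilpotent groups. If $\mathfrak{F}$ is solubly saturated (resp. normally hereditary, resp. Fitting), then $\mathfrak{F}_{\mathfrak{J}cs}$ is a solubly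 saturated (resp. normally hereditary, resp. Fitting) formation. -/

import Mathlib

universe u

/-- A class of groups, as a predicate. That the predicate holds for finite groups only and is
invariant under isomorphism is part of the properties below. -/
abbrev GroupClass : Type (u + 1) := ∀ (G : Type u) [Group G], Prop

namespace GroupClass

/-- A class of finite non-abelian simple groups (closed under isomorphism). -/
structure IsNonabelianSimple (J : GroupClass.{u}) : Prop where
  finite : ∀ (G : Type u) [Group G], J G → Finite G
  iso : ∀ (G H : Type u) [Group G] [Group H], G ≃* H → J G → J H
  simple : ∀ (G : Type u) [Group G], J G → IsSimpleGroup G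
  nonabelian : ∀ (G : Type u) [Group G], J G → ∃ a b : G, a * b ≠ b * a

/-- A formation of finite groups: closed under homomorphic images, and `G / (M ∩ N)` is in the
class whenever `G / M` and `G / N` are. -/
structure IsFormation (X : GroupClass.{u}) : Prop where
  finite : ∀ (G : Type u) [Group G], X G → Finite G
  image : ∀ (G H : Type u) [Group G] [Group H] (f : G →* H),
    Function.Surjective f → X G → X H
  inf : ∀ (G : Type u) [Group G] [Finite G] (M N : Subgroup G) [M.Normal] [N.Normal],
    X (G ⧸ M) → X (G ⧸ N) → X (G ⧸ (M ⊓ N))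

/-- `G` is in the class whenever `G / Φ(N)` is, for some soluble normal subgroup `N` of the finite
group `G`. -/
def SolublySaturated (X : GroupClass.{u}) : Prop :=
  ∀ (G : Type u) [Group G] [Finite G] (N : Subgroup G) [N.Normal],
    Group.IsSolvable N → X (G ⧸ (frattini N).map N.subtype) → X G

/-- Closed under normal subgroups. -/
def NormallyHereditary (X : GroupClass.{u}) : Prop :=
  ∀ (G : Type u) [Group G] [Finite G] (N : Subgroup G) [N.Normal], X G → X N

/-- Closed under normal subgroups and under products of two normal subgroups
(for normal `A`, `B` the join `A ⊔ B` is the product set `AB`). -/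
def Fitting (X : GroupClass.{u}) : Prop :=
  X.NormallyHereditary ∧
    ∀ (G : Type u) [Group G] [Finite G] (A B : Subgroup G) [A.Normal] [B.Normal],
      A ⊔ B = ⊤ → X A → X B → X G

/-- Every finite nilpotent group is in the class. -/
def ContainsNilpotent (X : GroupClass.{u}) : Prop :=
  ∀ (G : Type u) [Group G] [Finite G], Group.IsNilpotent G → X G

end GroupClass

section ChiefFactor

variable {G : Type u} [Group G]

/-- For normal subgroups `K ≤ H` of `G`: `H / K` is a chief factor of `G`, that is, `K < H` and no
normal subgroup of `G` lies strictly between them. -/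
def IsChiefFactor (H K : Subgroup G) : Prop :=
  K < H ∧ ∀ L : Subgroup G, L.Normal → K ≤ L → L ≤ H → L = K ∨ L = H

/-- The underlying group of the factor `H / K`. -/
abbrev Factor (H K : Subgroup G) : Type u := H ⧸ K.subgroupOf H

theorem map_conjNormal_subgroupOf (H K : Subgroup G) [H.Normal] [hK : K.Normal] (g : G) :
    (K.subgroupOf H).map (MulAut.conjNormal g : H ≃* H).toMonoidHom = K.subgroupOf H := by
  ext x
  simp only [Subgroup.mem_map, Subgroup.mem_subgroupOf]
  constructor
  · rintro ⟨y, hy, rfl⟩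
    simpa using hK.conj_mem _ hy g
  · intro hx
    refine ⟨(MulAut.conjNormal g : H ≃* H).symm x, ?_, by simp⟩
    have := hK.conj_mem _ hx g⁻¹
    simpa [MulAut.conjNormal_symm_apply] using this

/-- The action of `G` on `H / K` by conjugation: `g • hK = (g h g⁻¹)K`. -/
def factorConj (H K : Subgroup G) [H.Normal] [K.Normal] : G →* MulAut (Factor H K) where
  toFun g := QuotientGroup.congr (K.subgroupOf H) (K.subgroupOf H) (MulAut.conjNormal g)
    (map_conjNormal_subgroupOf H K g)
  map_one' := by
    ext x
    induction x using QuotientGroup.induction_on with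
    | H h => simp
  map_mul' a b := by
    ext x
    induction x using QuotientGroup.induction_on with
    | H h => simp; rfl

/-- The centralizer `C_G(H / K)`: the kernel of the conjugation action. -/
abbrev factorCentralizer (H K : Subgroup G) [H.Normal] [K.Normal] : Subgroup G :=
  (factorConj H K).ker

/-- The group `(H / K) ⋊ G / C_G(H / K)`, with the action induced by conjugation. -/
abbrev FactorSemidirect (H K : Subgroup G) [H.Normal] [K.Normal] : Type u :=
  Factor H K ⋊[QuotientGroup.kerLift (factorConj H K)] (G ⧸ factorCentralizer H K)

end ChiefFactor

namespace GroupClass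

/-- The factor `H / K` of `G` is `X`-central in `G`. -/
def IsCentral (X : GroupClass.{u}) {G : Type u} [Group G] (H K : Subgroup G)
    [H.Normal] [K.Normal] : Prop :=
  X (FactorSemidirect H K)

/-- The class of all finite groups in which every chief factor that is an `X`-group is
`X`-central and every other chief factor is a (simple) `J`-group. -/
def Jcs (J X : GroupClass.{u}) : GroupClass.{u} := fun G _ =>
  Finite G ∧ ∀ (H K : Subgroup G) [H.Normal] [K.Normal], IsChiefFactor H K →
    (X (Factor H K) → X.IsCentral H K) ∧
    (¬ X (Factor H K) → IsSimpleGroup (Factor H K) ∧ J (Factor H K))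

end GroupClass

/-! Centrality of `H/K` is a property of the group of automorphisms that `G` induces on it.
`Central` expresses this for an arbitrary action, and `central_transfer` carries it along
equivariant maps. A chief factor is perspective either to one above a given normal subgroup or to
one below it (`IsChiefFactor.dichotomy`). This takes the place of the Jordan–Hölder theorem: it
gives the formation property at once, and in the three inductions on the group order it reduces
attention to a minimal normal subgroup `W`.

Normal heredity. Let `W ≤ N` be minimal normal in `G`. If `W` is in `F`, then `W` is central for
`N`, and so is every `N`-section of `W`, because a formation containing `E` contains `A ⋊ E` for `A`
normal in `E` (`semidirect_conjNormal`, `central_section`). Otherwise `W` is simple and is itself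
the only chief factor to check.

Fitting. Let `G = AB`. If `W ≤ A`, the kernels of the `A`-chief quotients of `W` have trivial
intersection, since `G` permutes them. If `W` is in `F`, these quotients are central, so `W` is
central for `A`; the same holds for `B`, and the Fitting property of `F` joins the two. If `W` is
not in `F` and lies in both `A` and `B`, there are families of simple `J`-quotients for `A` and for
`B`. A non-abelian simple quotient factors through a member of any residual family
(`exists_ker_le_of_simple`), so some kernel is invariant under both `A` and `B`; it is normal in
`G`, hence trivial, and `W` is simple.

Soluble saturation. Take `W ≤ Φ(N)`, an elementary abelian `p`-group. Chief factors of `G` between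
`W` and `N` are abelian, so they lie in `F` and are central by induction. After removing normal
`p'`-subgroups, the common centralizer `R` of the `p`-chief factors between `W` and `N` also
centralizes `W` (`centralizes_frattini_factor`). Thus `W` is an irreducible module for `B = G/R`,
and the `p`-chief factors are jointly faithful modules whose semidirect products with `B` are in
`F`. A variant of the Burnside–Brauer theorem then gives `W ⋊ B` in `F`
(`semidirect_of_irreducible`): functions `B → ZMod p` arising from modules with semidirect product
in `F` form a point-separating algebra, hence are all functions. Closure under products is where
saturation of `F` enters, through a Heisenberg group whose centre contains the span of the products
inside its Frattini subgroup. -/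

open SemidirectProduct
open scoped commutatorElement

/-! ### Maps between semidirect products -/

namespace SemidirectProduct

variable {N G N' G' : Type*} [Group N] [Group G] [Group N'] [Group G']
  {φ : G →* MulAut N} {ψ : G' →* MulAut N'}

theorem finite [Finite N] [Finite G] : Finite (N ⋊[φ] G) :=
  Finite.of_equiv _ equivProd.symm

/-- The homomorphism of semidirect products given by an equivariant pair of homomorphisms. -/
def mapPair (f : N →* N') (s : G →* G') (h : ∀ g v, f (φ g v) = ψ (s g) (f v)) :
    N ⋊[φ] G →* N' ⋊[ψ] G' :=
  map f s fun g => MonoidHom.ext fun v => h g v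

theorem mapPair_surjective {f : N →* N'} {s : G →* G'}
    (h : ∀ g v, f (φ g v) = ψ (s g) (f v)) (hf : Function.Surjective f)
    (hs : Function.Surjective s) : Function.Surjective (mapPair f s h) := by
  rintro ⟨v, g⟩
  obtain ⟨v, rfl⟩ := hf v
  obtain ⟨g, rfl⟩ := hs g
  exact ⟨⟨v, g⟩, rfl⟩

end SemidirectProduct

/-! ### Formations and central actions -/

namespace GroupClass


/-- The image of the action `φ` acts on `V` with semidirect product in the class. -/
def Central (X : GroupClass.{u}) {V G : Type u} [Group V] [Group G] (φ : G →* MulAut V) : Prop :=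
  X (V ⋊[φ.range.subtype] φ.range)

variable {X : GroupClass.{u}}

namespace IsFormation

theorem of_equiv (hX : X.IsFormation) {G H : Type u} [Group G] [Group H] (e : G ≃* H)
    (h : X G) : X H :=
  hX.image G H e.toMonoidHom e.surjective h

theorem congr (hX : X.IsFormation) {G H : Type u} [Group G] [Group H] (e : G ≃* H) :
    X G ↔ X H :=
  ⟨hX.of_equiv e, hX.of_equiv e.symm⟩

theorem of_subsingleton (hN : X.ContainsNilpotent) (G : Type u) [Group G]
    [Subsingleton G] : X G :=
  hN G inferInstance

/-- A residual product of members of a formation is a member. -/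
theorem of_family (hX : X.IsFormation) (hN : X.ContainsNilpotent) {E : Type u} [Group E]
    [Finite E] {ι : Type*} [Finite ι] (Q : ι → Type u) [∀ i, Group (Q i)] (q : ∀ i, E →* Q i)
    (hq : ∀ i, Function.Surjective (q i)) (hQ : ∀ i, X (Q i))
    (h : ∀ x, (∀ i, q i x = 1) → x = 1) : X E := by
  classical
  have key : ∀ s : Finset ι, ∀ (M : Subgroup E) [M.Normal],
      (∀ x, x ∈ M ↔ ∀ i ∈ s, q i x = 1) → X (E ⧸ M) := by
    intro s
    induction s using Finset.induction_on with
    | empty =>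
      intro M _ hM
      have : M = ⊤ := by ext x; simp [hM]
      have : Subsingleton (E ⧸ M) := by
        rw [this]; exact QuotientGroup.subsingleton_quotient_top
      exact of_subsingleton hN _
    | insert a s ha ih =>
      intro M _ hM
      have hn : (⨅ i ∈ s, (q i).ker).Normal :=
        Subgroup.normal_iInf_normal fun i => Subgroup.normal_iInf_normal fun _ => inferInstance
      have h1 : X (E ⧸ (⨅ i ∈ s, (q i).ker)) := ih _ (by simp [Subgroup.mem_iInf])
      have h2 : X (E ⧸ (q a).ker) :=
        hX.of_equiv (QuotientGroup.quotientKerEquivOfSurjective _ (hq a)).symm (hQ a)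
      have h3 := hX.inf E _ _ h2 h1
      refine hX.of_equiv (QuotientGroup.quotientMulEquivOfEq ?_) h3
      ext x
      simp [hM, Subgroup.mem_iInf]
  cases nonempty_fintype ι
  have := key Finset.univ ⊥ (fun x => ⟨by rintro rfl; simp, fun hx => h x (by simpa using hx)⟩)
  exact hX.of_equiv QuotientGroup.quotientBot this

theorem of_pair (hX : X.IsFormation) {E Q R : Type u} [Group E] [Group Q] [Group R]
    [Finite E] (q : E →* Q) (r : E →* R) (hq : Function.Surjective q)
    (hr : Function.Surjective r) (hQ : X Q) (hR : X R)
    (h : ∀ x, q x = 1 → r x = 1 → x = 1) : X E := by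
  have h1 : X (E ⧸ q.ker) :=
    hX.of_equiv (QuotientGroup.quotientKerEquivOfSurjective _ hq).symm hQ
  have h2 : X (E ⧸ r.ker) :=
    hX.of_equiv (QuotientGroup.quotientKerEquivOfSurjective _ hr).symm hR
  have h3 := hX.inf E _ _ h1 h2
  have : q.ker ⊓ r.ker = ⊥ := by
    rw [eq_bot_iff]
    rintro x ⟨hx, hx'⟩
    exact h x hx hx'
  exact hX.of_equiv ((QuotientGroup.quotientMulEquivOfEq this).trans QuotientGroup.quotientBot) h3

theorem semidirect_image (hX : X.IsFormation) {V V' G G' : Type u} [Group V] [Group V']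
    [Group G] [Group G'] {φ : G →* MulAut V} {ψ : G' →* MulAut V'} (f : V →* V') (s : G →* G')
    (hf : Function.Surjective f) (hs : Function.Surjective s)
    (h : ∀ g v, f (φ g v) = ψ (s g) (f v)) (hV : X (V ⋊[φ] G)) : X (V' ⋊[ψ] G') :=
  hX.image _ _ (mapPair f s h) (mapPair_surjective h hf hs) hV

theorem central_of_semidirect (hX : X.IsFormation) {V G : Type u} [Group V]
    [Group G] {φ : G →* MulAut V} (h : X (V ⋊[φ] G)) : X.Central φ :=
  hX.semidirect_image (MonoidHom.id V) φ.rangeRestrict Function.surjective_id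
    φ.rangeRestrict_surjective (fun _ _ => rfl) h

/-- By the first isomorphism theorem `G / C_G(H/K)` may be replaced by the image of the action. In
this form acting groups with the same image become interchangeable. -/
theorem isCentral_iff (hX : X.IsFormation) {G : Type u} [Group G] (H K : Subgroup G) [H.Normal]
    [K.Normal] : X.IsCentral H K ↔ X.Central (factorConj H K) := by
  let e := QuotientGroup.quotientKerEquivRange (factorConj H K)
  have he : ∀ (x : G ⧸ (factorConj H K).ker),
      ((e x : MulAut (Factor H K))) = QuotientGroup.kerLift (factorConj H K) x := by
    intro x
    induction x using QuotientGroup.induction_on with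
    | H g => rfl
  constructor
  · exact hX.semidirect_image (MonoidHom.id _) e.toMonoidHom Function.surjective_id e.surjective
      (fun g v => by
        change _ = ((e g : MulAut (Factor H K))) v
        rw [he]; rfl)
  · exact hX.semidirect_image (MonoidHom.id _) e.symm.toMonoidHom Function.surjective_id
      e.symm.surjective (fun g v => by
        change _ = QuotientGroup.kerLift (factorConj H K) (e.symm g) v
        rw [← he]; simp)

/-- Centrality only depends on the group of automorphisms that is induced. -/
theorem central_transfer (hX : X.IsFormation) {V V' G G' : Type u} [Group V] [Group V']
    [Group G] [Group G'] {φ : G →* MulAut V} {ψ : G' →* MulAut V'} (f : V →* V')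
    (hf : Function.Surjective f) (h₁ : ∀ g, ∃ g', ∀ v, f (φ g v) = ψ g' (f v))
    (h₂ : ∀ g', ∃ g, ∀ v, f (φ g v) = ψ g' (f v)) (h : X.Central φ) : X.Central ψ := by
  have h₃ : ∀ α : φ.range, ∃ β : ψ.range, ∀ v, f ((α : MulAut V) v) = (β : MulAut V') (f v) := by
    rintro ⟨_, g, rfl⟩
    obtain ⟨g', hg⟩ := h₁ g
    exact ⟨⟨_, g', rfl⟩, hg⟩
  choose t ht using h₃
  -- As `f` is surjective, the automorphism induced on `V'` is unique; this makes the chosen `t`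
  -- multiplicative.
  have hu : ∀ β γ : ψ.range, (∀ v, (β : MulAut V') (f v) = (γ : MulAut V') (f v)) → β = γ := by
    intro β γ hβ
    ext w
    obtain ⟨v, rfl⟩ := hf w
    exact hβ v
  let s : φ.range →* ψ.range := MonoidHom.mk' t (by
    intro a b
    refine hu _ _ fun v => ?_
    rw [← ht]
    simp only [Subgroup.coe_mul, MulAut.mul_apply]
    rw [ht, ht])
  refine hX.semidirect_image f s hf ?_ (fun g v => ht g v) h
  rintro ⟨_, g', rfl⟩
  obtain ⟨g, hg⟩ := h₂ g'
  refine ⟨⟨_, g, rfl⟩, hu _ _ fun v => ?_⟩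
  exact (ht _ v).symm.trans (hg v)

/-- For a normal subgroup `A` of a member `E`, the semidirect product `A ⋊ E` is a member. -/
theorem semidirect_conjNormal (hX : X.IsFormation) {E : Type u} [Group E] (hE : X E)
    (A : Subgroup E) [A.Normal] : X (A ⋊[(MulAut.conjNormal : E →* MulAut A)] E) := by
  have : Finite E := hX.finite E hE
  have : Finite (A ⋊[(MulAut.conjNormal : E →* MulAut A)] E) := SemidirectProduct.finite
  -- The maps `(a, e) ↦ e` and `(a, e) ↦ a * e` have trivial common kernel, so `A ⋊ E` is a
  -- subdirect product of two copies of `E`.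
  let r : A ⋊[(MulAut.conjNormal : E →* MulAut A)] E →* E :=
    { toFun := fun x => x.left * x.right
      map_one' := by simp
      map_mul' := fun x y => by simp [mul_assoc] }
  refine hX.of_pair rightHom r rightHom_surjective (fun e => ⟨inr e, by simp [r]⟩) hE hE ?_
  rintro ⟨a, e⟩ h1 h2
  simp only [rightHom_eq_right] at h1
  subst h1
  simp [r] at h2
  subst h2
  rfl

theorem prod (hX : X.IsFormation) {G H : Type u} [Group G] [Group H] (hG : X G) (hH : X H) :
    X (G × H) := by
  have := hX.finite G hG
  have := hX.finite H hH
  refine hX.of_pair (MonoidHom.fst G H) (MonoidHom.snd G H) Prod.fst_surjective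
    Prod.snd_surjective hG hH ?_
  rintro ⟨a, b⟩ rfl rfl
  rfl

/-- Sections of a module with semidirect product in the class. -/
theorem central_section (hX : X.IsFormation) {V V' G : Type u} [Group V] [Group V'] [Group G]
    {φ : G →* MulAut V} {ψ : G →* MulAut V'} (h : X.Central φ)
    (hinn : ∀ v : V, ∃ g, φ g = MulAut.conj v) (A : Subgroup V)
    (hA : ∀ g, ∀ a ∈ A, φ g a ∈ A) (f : A →* V') (hf : Function.Surjective f)
    (hψ : ∀ g (a : A), f ⟨φ g a, hA g a a.2⟩ = ψ g (f a)) : X.Central ψ := by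
  let E := V ⋊[φ.range.subtype] φ.range
  let B : Subgroup E := A.map inl
  -- Conjugation by `(v, φ g)` is `φ g` followed by an inner automorphism, and `hinn` absorbs the
  -- latter. So `E` and `G` induce the same automorphisms on `A`.
  have hconj : ∀ e : E, ∃ g, ∀ a : V, e * inl a * e⁻¹ = inl (φ g a) := by
    rintro ⟨v, ⟨_, g, rfl⟩⟩
    obtain ⟨g', hg'⟩ := hinn v
    refine ⟨g' * g, fun a => ?_⟩
    have h1 := inl_aut (φ := φ.range.subtype) ⟨φ g, g, rfl⟩ a
    have h2 : inl ((φ (g' * g)) a) = inl v * inl (φ g a) * (inl v)⁻¹ :=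
      (by rw [map_mul, hg']; simp : (inl ((φ (g' * g)) a) : E) = _)
    rw [h2, mk_eq_inl_mul_inr, mul_inv_rev]
    change _ = inl v * (inl (φ.range.subtype ⟨φ g, g, rfl⟩ a) : E) * _
    rw [h1, map_inv]
    group
  have hB : B.Normal := by
    constructor
    rintro _ ⟨a, ha, rfl⟩ e
    obtain ⟨g, hg⟩ := hconj e
    exact ⟨φ g a, hA g a ha, (hg a).symm⟩
  let i : A ≃* B := A.equivMapOfInjective inl inl_injective
  have hi : ∀ a : A, ((i a : B) : E) = inl (a : V) := fun a => rfl
  have key : ∀ (e : E) (g : G), (∀ a : V, e * inl a * e⁻¹ = inl (φ g a)) →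
      ∀ b : B, (f.comp i.symm.toMonoidHom) (MulAut.conjNormal e b) =
        ψ g ((f.comp i.symm.toMonoidHom) b) := by
    intro e g hg b
    obtain ⟨a, rfl⟩ := i.surjective b
    have : MulAut.conjNormal e (i a) = i ⟨φ g a, hA g a a.2⟩ := by
      apply Subtype.ext
      rw [MulAut.conjNormal_apply, hi, hi, hg]
    simp [this, hψ]
  refine hX.central_transfer (φ := (MulAut.conjNormal : E →* MulAut B))
    (f.comp i.symm.toMonoidHom) (hf.comp i.symm.surjective) ?_ ?_
    (hX.central_of_semidirect (hX.semidirect_conjNormal h B))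
  · intro e
    obtain ⟨g, hg⟩ := hconj e
    exact ⟨g, key e g hg⟩
  · intro g
    refine ⟨inr ⟨φ g, g, rfl⟩, key _ g fun a => ?_⟩
    rw [← map_inv, ← inl_aut]
    rfl

/-- An action is central if it is so on a residual family of equivariant quotients. -/
theorem central_of_family (hX : X.IsFormation) (hN : X.ContainsNilpotent) {V G : Type u}
    [Group V] [Finite V] [Group G] {φ : G →* MulAut V} {ι : Type*} [Finite ι] (V' : ι → Type u)
    [∀ i, Group (V' i)] (ψ : ∀ i, G →* MulAut (V' i)) (f : ∀ i, V →* V' i)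
    (hf : ∀ i, Function.Surjective (f i)) (hψ : ∀ i g v, f i (φ g v) = ψ i g (f i v))
    (h : ∀ v, (∀ i, f i v = 1) → v = 1) (hc : ∀ i, X.Central (ψ i)) : X.Central φ := by
  have : Finite (MulAut V) := Finite.of_injective (fun e : MulAut V => (e : V → V))
    DFunLike.coe_injective
  have hfin : Finite (V ⋊[φ.range.subtype] φ.range) := SemidirectProduct.finite
  have hu : ∀ i, ∀ g g', φ g = φ g' → ψ i g = ψ i g' := by
    intro i g g' hg
    ext w
    obtain ⟨v, rfl⟩ := hf i w
    rw [← hψ, ← hψ, hg]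
  have hs : ∀ i, ∃ s : φ.range →* (ψ i).range, ∀ g, s ⟨φ g, g, rfl⟩ = ⟨ψ i g, g, rfl⟩ := by
    intro i
    refine ⟨((QuotientGroup.lift φ.ker (ψ i).rangeRestrict ?_)).comp
      (QuotientGroup.quotientKerEquivRange φ).symm.toMonoidHom, ?_⟩
    · intro g hg
      apply Subtype.ext
      exact (hu i g 1 (by simpa using hg)).trans (map_one _)
    · intro g
      have : (QuotientGroup.quotientKerEquivRange φ).symm ⟨φ g, g, rfl⟩ = (g : G ⧸ φ.ker) := by
        rw [MulEquiv.symm_apply_eq]; rfl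
      simp [this]
      rfl
  choose s hs using hs
  have hcomp : ∀ i (α : φ.range) v, f i ((α : MulAut V) v) = (s i α : MulAut (V' i)) (f i v) := by
    rintro i ⟨_, g, rfl⟩ v
    rw [hs]
    exact hψ i g v
  refine hX.of_family hN (fun i => V' i ⋊[(ψ i).range.subtype] (ψ i).range)
    (fun i => mapPair (f i) (s i) (hcomp i))
    (fun i => mapPair_surjective _ (hf i) ?_) hc ?_
  · rintro ⟨_, g, rfl⟩
    exact ⟨⟨φ g, g, rfl⟩, hs i g⟩
  · intro x hx
    have h1 : x.left = 1 := h _ fun i => congrArg SemidirectProduct.left (hx i)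
    -- If an automorphism is trivial on each quotient, it moves `v` by an element that every `f i`
    -- kills.
    have h2 : x.right = 1 := by
      ext v
      have : (x.right : MulAut V) v * v⁻¹ = 1 := h _ fun i => by
        have h3 : s i x.right = 1 := congrArg SemidirectProduct.right (hx i)
        rw [map_mul, hcomp, h3]
        simp
      simpa [mul_inv_eq_one] using this
    exact SemidirectProduct.ext h1 h2

end IsFormation

end GroupClass

/-! ### Chief factors and perspectivity -/

section Lattice

variable {G : Type*} [Group G]

/-- Dedekind's modular law. Normality of `K` makes `K ⊔ M` a product set. -/
theorem Subgroup.inf_sup_eq_sup_inf_of_le {K H : Subgroup G} [K.Normal] (h : K ≤ H)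
    (M : Subgroup G) : H ⊓ (K ⊔ M) = K ⊔ (H ⊓ M) := by
  apply le_antisymm
  · rintro x ⟨hx, hx'⟩
    obtain ⟨k, hk, m, hm, rfl⟩ := Subgroup.mem_sup_of_normal_left.1 hx'
    exact Subgroup.mul_mem_sup hk ⟨(H.mul_mem_cancel_left (h hk)).1 hx, hm⟩
  · exact sup_le (le_inf h le_sup_left) (inf_le_inf_left _ le_sup_right)

end Lattice

namespace IsChiefFactor

variable {G : Type u} [Group G] {H K H₁ K₁ H₂ K₂ : Subgroup G}

theorem perspective_up [H₁.Normal] [K₁.Normal] [K₂.Normal] (hs : H₁ ⊔ K₂ = H₂)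
    (hi : H₁ ⊓ K₂ = K₁) (h : IsChiefFactor H₁ K₁) : IsChiefFactor H₂ K₂ := by
  refine ⟨lt_of_le_of_ne (hs ▸ le_sup_right) ?_, fun L hL h₁ h₂ => ?_⟩
  · rintro rfl
    have : H₁ ≤ K₂ := hs ▸ le_sup_left
    rw [inf_eq_left.2 this] at hi
    exact h.1.ne hi.symm
  · have hLe : K₂ ⊔ (L ⊓ H₁) = L := by
      rw [← Subgroup.inf_sup_eq_sup_inf_of_le h₁, sup_comm, hs, inf_eq_left.2 h₂]
    rcases h.2 (L ⊓ H₁) inferInstance (hi ▸ le_inf (inf_le_right.trans h₁) inf_le_left)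
      inf_le_right with h3 | h3
    · left
      rw [← hLe, h3, ← hi]
      exact sup_eq_left.2 inf_le_right
    · right
      rw [← hLe, h3, sup_comm, hs]

theorem perspective_down [H₁.Normal] [K₂.Normal] (hs : H₁ ⊔ K₂ = H₂)
    (hi : H₁ ⊓ K₂ = K₁) (h : IsChiefFactor H₂ K₂) : IsChiefFactor H₁ K₁ := by
  refine ⟨lt_of_le_of_ne (hi ▸ inf_le_left) ?_, fun L hL h₁ h₂ => ?_⟩
  · rintro rfl
    rw [sup_eq_right.2 (inf_eq_left.1 hi)] at hs
    exact h.1.ne hs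
  · rcases h.2 (L ⊔ K₂) inferInstance le_sup_right (hs ▸ sup_le_sup_right h₂ _) with h3 | h3
    · left
      exact le_antisymm (hi ▸ le_inf h₂ (sup_eq_right.1 h3)) h₁
    · right
      have := Subgroup.inf_sup_eq_sup_inf_of_le h₂ K₂
      rw [h3, hi, sup_eq_left.2 h₁, ← hs, inf_eq_left.2 le_sup_left] at this
      exact this.symm

/-- In the first case `H/K` is perspective to `HM/KM`, above `M`; in the second, to `(H ∩ M)/(K ∩
M)`, below `M`. -/
theorem dichotomy [H.Normal] [K.Normal] (h : IsChiefFactor H K) (M : Subgroup G) [M.Normal] :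
    H ⊓ (K ⊔ M) = K ∨ (H ⊓ M) ⊔ K = H := by
  rcases h.2 (H ⊓ (K ⊔ M)) inferInstance (le_inf h.1.le le_sup_left) inf_le_left with h1 | h1
  · exact Or.inl h1
  · rw [Subgroup.inf_sup_eq_sup_inf_of_le h.1.le, sup_comm] at h1
    exact Or.inr h1

variable {G' : Type u} [Group G'] {π : G →* G'} {H' K' : Subgroup G'}

theorem of_comap (hπ : Function.Surjective π)
    (h : IsChiefFactor (H'.comap π) (K'.comap π)) : IsChiefFactor H' K' := by
  refine ⟨(Subgroup.comap_lt_comap_of_surjective hπ).1 h.1, fun L hL h₁ h₂ => ?_⟩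
  rcases h.2 (L.comap π) inferInstance (Subgroup.comap_mono h₁) (Subgroup.comap_mono h₂)
    with h3 | h3
  · exact Or.inl (Subgroup.comap_injective hπ h3)
  · exact Or.inr (Subgroup.comap_injective hπ h3)

theorem comap (hπ : Function.Surjective π) (h : IsChiefFactor H' K') :
    IsChiefFactor (H'.comap π) (K'.comap π) := by
  refine ⟨(Subgroup.comap_lt_comap_of_surjective hπ).2 h.1, fun L hL h₁ h₂ => ?_⟩
  have hker : π.ker ≤ L := (Subgroup.ker_le_comap _ _).trans h₁
  have hL' : (L.map π).comap π = L := Subgroup.comap_map_eq_self hker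
  rcases h.2 (L.map π) (hL.map _ hπ)
    ((Subgroup.comap_le_comap_of_surjective hπ).1 (by rwa [hL']))
    ((Subgroup.comap_le_comap_of_surjective hπ).1 (by rwa [hL'])) with h3 | h3
  · exact Or.inl (by rw [← hL', h3])
  · exact Or.inr (by rw [← hL', h3])

/-- A proper normal section of a finite group has a chief factor at its top. -/
theorem exists_lower [Finite G] [hK : K.Normal] (h : K < H) :
    ∃ L : Subgroup G, L.Normal ∧ K ≤ L ∧ IsChiefFactor H L := by
  have hfin : {L : Subgroup G | L.Normal ∧ K ≤ L ∧ L < H}.Finite := Set.toFinite _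
  obtain ⟨L, hL⟩ := hfin.exists_maximal ⟨K, hK, le_rfl, h⟩
  refine ⟨L, hL.1.1, hL.1.2.1, hL.1.2.2, fun M hM h₁ h₂ => ?_⟩
  rcases h₂.eq_or_lt with h3 | h3
  · exact Or.inr h3
  · exact Or.inl (le_antisymm (hL.2 ⟨hM, hL.1.2.1.trans h₁, h3⟩ h₁) h₁)

/-- A proper normal section of a finite group has a chief factor at its bottom. -/
theorem exists_upper [Finite G] [hH : H.Normal] (h : K < H) :
    ∃ L : Subgroup G, L.Normal ∧ L ≤ H ∧ IsChiefFactor L K := by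
  have hfin : {L : Subgroup G | L.Normal ∧ L ≤ H ∧ K < L}.Finite := Set.toFinite _
  obtain ⟨L, hL⟩ := hfin.exists_minimal ⟨H, hH, le_rfl, h⟩
  refine ⟨L, hL.1.1, hL.1.2.1, hL.1.2.2, fun M hM h₁ h₂ => ?_⟩
  rcases h₁.eq_or_lt with h3 | h3
  · exact Or.inl h3.symm
  · exact Or.inr (le_antisymm h₂ (hL.2 ⟨hM, h₂.trans hL.1.2.1, h3⟩ h₂))

end IsChiefFactor

/-! ### Operator isomorphisms between factors -/

section Factor

variable {G : Type u} [Group G]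

theorem factorConj_mk (H K : Subgroup G) [H.Normal] [K.Normal] (g : G) (h : H) :
    factorConj H K g (h : Factor H K) = ((MulAut.conjNormal g h : H) : Factor H K) := rfl

theorem factor_mk_eq_one {H K : Subgroup G} [K.Normal] (h : H) :
    (h : Factor H K) = 1 ↔ (h : G) ∈ K := by
  rw [QuotientGroup.eq_one_iff, Subgroup.mem_subgroupOf]

theorem mem_factorCentralizer {H K : Subgroup G} [H.Normal] [K.Normal] {g : G} :
    g ∈ factorCentralizer H K ↔ ∀ h ∈ H, g * h * g⁻¹ * h⁻¹ ∈ K := by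
  have key : ∀ h : H, factorConj H K g (h : Factor H K) = h ↔ g * h * g⁻¹ * (h : G)⁻¹ ∈ K := by
    intro h
    rw [factorConj_mk, ← mul_inv_eq_one, ← QuotientGroup.mk_inv, ← QuotientGroup.mk_mul,
      factor_mk_eq_one]
    simp
  constructor
  · intro hg h hh
    refine (key ⟨h, hh⟩).1 ?_
    rw [MonoidHom.mem_ker.1 hg]; rfl
  · intro hg
    rw [MonoidHom.mem_ker]
    ext v
    induction v using QuotientGroup.induction_on with
    | H h => exact (key h).2 (hg h h.2)

/-- Perspective factors are isomorphic as groups with operators. -/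
theorem exists_factor_equiv_of_perspective {H₁ K₁ H₂ K₂ : Subgroup G} [H₁.Normal] [K₁.Normal]
    [H₂.Normal] [K₂.Normal] (hs : H₁ ⊔ K₂ = H₂) (hi : H₁ ⊓ K₂ = K₁) :
    ∃ e : Factor H₁ K₁ ≃* Factor H₂ K₂,
      ∀ g v, e (factorConj H₁ K₁ g v) = factorConj H₂ K₂ g (e v) := by
  have hle : H₁ ≤ H₂ := hs ▸ le_sup_left
  let f : Factor H₁ K₁ →* Factor H₂ K₂ :=
    QuotientGroup.map _ _ (Subgroup.inclusion hle) (by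
      intro x hx
      have hx' : (x : G) ∈ K₁ := hx
      exact (hi ▸ inf_le_right : K₁ ≤ K₂) hx')
  have hf : Function.Bijective f := by
    constructor
    · rw [injective_iff_map_eq_one]
      intro v
      induction v using QuotientGroup.induction_on with
      | H h =>
        intro hv
        have : (h : G) ∈ K₂ := (factor_mk_eq_one (Subgroup.inclusion hle h)).1 hv
        rw [factor_mk_eq_one, ← hi]
        exact ⟨h.2, this⟩
    · intro v
      induction v using QuotientGroup.induction_on with
      | H h =>
        have hh : (h : G) ∈ H₁ ⊔ K₂ := hs ▸ h.2
        obtain ⟨a, ha, b, hb, hab⟩ := Subgroup.mem_sup_of_normal_right.1 hh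
        refine ⟨((⟨a, ha⟩ : H₁) : Factor H₁ K₁), ?_⟩
        refine (QuotientGroup.eq (s := K₂.subgroupOf H₂)).2 ?_
        rw [Subgroup.mem_subgroupOf]
        have : a⁻¹ * (h : G) = b := by rw [← hab]; group
        simpa [this] using hb
  refine ⟨MulEquiv.ofBijective f hf, fun g v => ?_⟩
  induction v using QuotientGroup.induction_on with
  | H h => rfl

theorem exists_factor_equiv_comap {G' : Type u} [Group G'] {π : G →* G'}
    (hπ : Function.Surjective π) (H' K' : Subgroup G') [H'.Normal] [K'.Normal] :
    ∃ e : Factor (H'.comap π) (K'.comap π) ≃* Factor H' K',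
      ∀ g v, e (factorConj _ _ g v) = factorConj H' K' (π g) (e v) := by
  let f : Factor (H'.comap π) (K'.comap π) →* Factor H' K' :=
    QuotientGroup.map _ _ (π.subgroupComap H') (fun x hx => hx)
  have hf : Function.Bijective f := by
    constructor
    · rw [injective_iff_map_eq_one]
      intro v
      induction v using QuotientGroup.induction_on with
      | H h =>
        intro hv
        have : π h ∈ K' := (factor_mk_eq_one (π.subgroupComap H' h)).1 hv
        rw [factor_mk_eq_one]
        exact this
    · intro v
      induction v using QuotientGroup.induction_on with
      | H h =>
        obtain ⟨g, hg⟩ := hπ h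
        refine ⟨((⟨g, by simp [hg]⟩ : H'.comap π) : Factor _ _), ?_⟩
        refine congrArg (QuotientGroup.mk (s := K'.subgroupOf H')) ?_
        exact Subtype.ext hg
  refine ⟨MulEquiv.ofBijective f hf, fun g v => ?_⟩
  induction v using QuotientGroup.induction_on with
  | H h =>
    refine congrArg (QuotientGroup.mk (s := K'.subgroupOf H')) ?_
    refine Subtype.ext ?_
    change π (MulAut.conjNormal g h : _) = π g * π h * (π g)⁻¹
    rw [MulAut.conjNormal_apply, map_mul, map_mul, map_inv]

theorem exists_factor_bot_equiv (W : Subgroup G) [W.Normal] :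
    ∃ e : W ≃* Factor W (⊥ : Subgroup G),
      ∀ g v, e (MulAut.conjNormal g v) = factorConj W ⊥ g (e v) :=
  ⟨QuotientGroup.quotientBot.symm.trans
    (QuotientGroup.quotientMulEquivOfEq (Subgroup.bot_subgroupOf W).symm), fun _ _ => rfl⟩

end Factor

/-! ### The class `Jcs` is a formation -/

namespace GroupClass

/-- The condition on a chief factor in `Jcs`, for an arbitrary action `φ` on a group `V`. -/
def Good (J F : GroupClass.{u}) {V G : Type u} [Group V] [Group G] (φ : G →* MulAut V) : Prop :=
  (F V → F.Central φ) ∧ (¬ F V → IsSimpleGroup V ∧ J V)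

variable {J F : GroupClass.{u}}

theorem Good.transfer (hJ : J.IsNonabelianSimple) (hF : F.IsFormation) {V V' G G' : Type u}
    [Group V] [Group V'] [Group G] [Group G'] {φ : G →* MulAut V} {ψ : G' →* MulAut V'}
    (e : V ≃* V') (h₁ : ∀ g, ∃ g', ∀ v, e (φ g v) = ψ g' (e v))
    (h₂ : ∀ g', ∃ g, ∀ v, e (φ g v) = ψ g' (e v)) (h : Good J F φ) : Good J F ψ := by
  constructor
  · intro hV
    exact hF.central_transfer e.toMonoidHom e.surjective h₁ h₂ (h.1 ((hF.congr e).2 hV))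
  · intro hV
    obtain ⟨hs, hj⟩ := h.2 (fun hV' => hV ((hF.congr e).1 hV'))
    have hJ' := hJ.iso _ _ e hj
    exact ⟨hJ.simple _ hJ', hJ'⟩

theorem Good.transfer_symm (hJ : J.IsNonabelianSimple) (hF : F.IsFormation) {V V' G G' : Type u}
    [Group V] [Group V'] [Group G] [Group G'] {φ : G →* MulAut V} {ψ : G' →* MulAut V'}
    (e : V ≃* V') (h₁ : ∀ g, ∃ g', ∀ v, e (φ g v) = ψ g' (e v))
    (h₂ : ∀ g', ∃ g, ∀ v, e (φ g v) = ψ g' (e v)) (h : Good J F ψ) : Good J F φ := by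
  refine h.transfer hJ hF e.symm (fun g' => ?_) (fun g => ?_)
  · obtain ⟨g, hg⟩ := h₂ g'
    exact ⟨g, fun v => by rw [e.symm_apply_eq, hg]; simp⟩
  · obtain ⟨g', hg⟩ := h₁ g
    exact ⟨g', fun v => by rw [e.symm_apply_eq, hg]; simp⟩

theorem jcs_iff (hF : F.IsFormation) {G : Type u} [Group G] :
    Jcs J F G ↔ Finite G ∧ ∀ (H K : Subgroup G) [H.Normal] [K.Normal],
      IsChiefFactor H K → Good J F (factorConj H K) := by
  refine and_congr_right fun _ => ?_
  refine forall_congr' fun H => forall_congr' fun K => forall_congr' fun _ =>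
    forall_congr' fun _ => forall_congr' fun _ => ?_
  rw [hF.isCentral_iff]
  rfl

section

variable (hJ : J.IsNonabelianSimple) (hF : F.IsFormation) {G G' : Type u} [Group G] [Group G']

include hJ hF

theorem good_perspective {H₁ K₁ H₂ K₂ : Subgroup G} [H₁.Normal] [K₁.Normal]
    [H₂.Normal] [K₂.Normal] (hs : H₁ ⊔ K₂ = H₂) (hi : H₁ ⊓ K₂ = K₁) :
    Good J F (factorConj H₁ K₁) ↔ Good J F (factorConj H₂ K₂) := by
  obtain ⟨e, he⟩ := exists_factor_equiv_of_perspective hs hi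
  exact ⟨Good.transfer hJ hF e (fun g => ⟨g, he g⟩) (fun g => ⟨g, he g⟩),
    Good.transfer_symm hJ hF e (fun g => ⟨g, he g⟩) (fun g => ⟨g, he g⟩)⟩

theorem good_comap {π : G →* G'} (hπ : Function.Surjective π) (H' K' : Subgroup G')
    [H'.Normal] [K'.Normal] :
    Good J F (factorConj (H'.comap π) (K'.comap π)) ↔ Good J F (factorConj H' K') := by
  obtain ⟨e, he⟩ := exists_factor_equiv_comap hπ H' K'
  have h₁ : ∀ g : G, ∃ g', ∀ v, e (factorConj _ _ g v) = factorConj H' K' g' (e v) :=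
    fun g => ⟨_, he g⟩
  have h₂ : ∀ g', ∃ g, ∀ v, e (factorConj _ _ g v) = factorConj H' K' g' (e v) := by
    intro g'
    obtain ⟨g, rfl⟩ := hπ g'
    exact ⟨g, he g⟩
  exact ⟨Good.transfer hJ hF e h₁ h₂, Good.transfer_symm hJ hF e h₁ h₂⟩

theorem good_bot (W : Subgroup G) [W.Normal] :
    Good J F (MulAut.conjNormal : G →* MulAut W) ↔ Good J F (factorConj W ⊥) := by
  obtain ⟨e, he⟩ := exists_factor_bot_equiv W
  exact ⟨Good.transfer hJ hF e (fun g => ⟨g, he g⟩) (fun g => ⟨g, he g⟩),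
    Good.transfer_symm hJ hF e (fun g => ⟨g, he g⟩) (fun g => ⟨g, he g⟩)⟩

theorem Jcs.image {π : G →* G'} (hπ : Function.Surjective π) (h : Jcs J F G) : Jcs J F G' := by
  rw [jcs_iff hF] at h ⊢
  have := h.1
  refine ⟨Finite.of_surjective π hπ, fun H K _ _ hc => ?_⟩
  exact (good_comap hJ hF hπ H K).1 (h.2 _ _ (hc.comap hπ))

theorem Jcs.good_of_ker_le {π : G →* G'} (hπ : Function.Surjective π) (h : Jcs J F G')
    {H K : Subgroup G} [hHn : H.Normal] [hKn : K.Normal] (hK : π.ker ≤ K)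
    (hc : IsChiefFactor H K) : Good J F (factorConj H K) := by
  rw [jcs_iff hF] at h
  obtain ⟨H', hH', rfl⟩ : ∃ H' : Subgroup G', H'.Normal ∧ H'.comap π = H :=
    ⟨H.map π, hHn.map _ hπ, Subgroup.comap_map_eq_self (hK.trans hc.1.le)⟩
  obtain ⟨K', hK', rfl⟩ : ∃ K' : Subgroup G', K'.Normal ∧ K'.comap π = K :=
    ⟨K.map π, hKn.map _ hπ, Subgroup.comap_map_eq_self hK⟩
  exact (good_comap hJ hF hπ H' K').2 (h.2 _ _ (hc.of_comap hπ))

/-- Each chief factor is perspective either to one above `π.ker`, which `G'` controls, or to one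
inside `π.ker`, and `Good` is invariant under perspectivity. -/
theorem Jcs.of_quotient [Finite G] {π : G →* G'} (hπ : Function.Surjective π) (h : Jcs J F G')
    (hk : ∀ (H K : Subgroup G) [H.Normal] [K.Normal], IsChiefFactor H K → H ≤ π.ker →
      Good J F (factorConj H K)) : Jcs J F G := by
  rw [jcs_iff hF]
  refine ⟨inferInstance, fun H K _ _ hc => ?_⟩
  rcases hc.dichotomy π.ker with h1 | h1
  · have hs : H ⊔ (K ⊔ π.ker) = H ⊔ (K ⊔ π.ker) := rfl
    rw [good_perspective hJ hF hs h1]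
    exact h.good_of_ker_le hJ hF hπ le_sup_right (hc.perspective_up hs h1)
  · have hi : (H ⊓ π.ker) ⊓ K = (H ⊓ π.ker) ⊓ K := rfl
    rw [← good_perspective hJ hF h1 hi]
    exact hk _ _ (hc.perspective_down h1 hi) inf_le_right

theorem Jcs.of_pair [Finite G] {G'' : Type u} [Group G''] {π : G →* G'} {ρ : G →* G''}
    (hπ : Function.Surjective π) (hρ : Function.Surjective ρ) (h : Jcs J F G')
    (h' : Jcs J F G'') (hk : π.ker ⊓ ρ.ker = ⊥) : Jcs J F G := by
  refine Jcs.of_quotient hJ hF hπ h fun H K _ _ hc hH => ?_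
  rcases hc.dichotomy ρ.ker with h1 | h1
  · have hs : H ⊔ (K ⊔ ρ.ker) = H ⊔ (K ⊔ ρ.ker) := rfl
    rw [good_perspective hJ hF hs h1]
    exact h'.good_of_ker_le hJ hF hρ le_sup_right (hc.perspective_up hs h1)
  -- A factor inside `π.ker` cannot be perspective to one inside `ρ.ker`, as the two kernels meet
  -- trivially.
  · have : H ⊓ ρ.ker = ⊥ := le_bot_iff.1 (hk ▸ inf_le_inf_right _ hH)
    rw [this, bot_sup_eq] at h1
    exact absurd h1 hc.1.ne

theorem Jcs.isFormation : (Jcs J F).IsFormation where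
  finite _ _ h := h.1
  image _ _ _ _ _ hf h := h.image hJ hF hf
  inf G _ _ M N _ _ hM hN := by
    have hle : M ⊓ N ≤ M.comap (MonoidHom.id G) := inf_le_left
    have hle' : M ⊓ N ≤ N.comap (MonoidHom.id G) := inf_le_right
    have hsurj : ∀ (L : Subgroup G) [L.Normal] (h : M ⊓ N ≤ L.comap (MonoidHom.id G)),
        Function.Surjective (QuotientGroup.map (M ⊓ N) L (MonoidHom.id G) h) := by
      intro L _ h x
      induction x using QuotientGroup.induction_on with
      | H g => exact ⟨g, rfl⟩
    refine Jcs.of_pair hJ hF (hsurj M hle) (hsurj N hle') hM hN ?_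
    rw [eq_bot_iff]
    rintro x ⟨h1, h2⟩
    induction x using QuotientGroup.induction_on with
    | H g =>
      have h1 : (g : G ⧸ M) = 1 := h1
      have h2 : (g : G ⧸ N) = 1 := h2
      rw [QuotientGroup.eq_one_iff] at h1 h2
      exact (QuotientGroup.eq_one_iff g).2 ⟨h1, h2⟩

/-- Over a minimal normal subgroup `W`, it suffices to look at `W` itself. -/
theorem Jcs.of_minimal [Finite G] {π : G →* G'} (hπ : Function.Surjective π) (h : Jcs J F G')
    {W : Subgroup G} [W.Normal] (hW : IsChiefFactor W ⊥) (hk : π.ker = W)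
    (hg : Good J F (MulAut.conjNormal : G →* MulAut W)) : Jcs J F G := by
  refine Jcs.of_quotient hJ hF hπ h fun H K _ _ hc hH => ?_
  rw [hk] at hH
  rcases hW.2 H inferInstance bot_le hH with rfl | rfl
  · exact absurd hc.1 not_lt_bot
  · rcases hW.2 K inferInstance bot_le hc.1.le with rfl | rfl
    · exact (good_bot hJ hF _).1 hg
    · exact absurd hc.1 (lt_irrefl _)

end

end GroupClass

/-! ### Normal heredity -/

/-- The preimage of `S` in `V ⋊ T`, for groups `S ≤ T` of automorphisms of `V`. -/
def semidirectRestrict {V : Type u} [Group V] {S T : Subgroup (MulAut V)} (h : S ≤ T) :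
    ((S.subgroupOf T).comap (rightHom : V ⋊[T.subtype] T →* T)) ≃* V ⋊[S.subtype] S where
  toFun x := ⟨x.1.left, ⟨x.1.right, x.2⟩⟩
  invFun x := ⟨⟨x.left, ⟨x.right, h x.right.2⟩⟩, x.right.2⟩
  left_inv _ := rfl
  right_inv _ := rfl
  map_mul' _ _ := rfl

namespace GroupClass

variable {J F : GroupClass.{u}}

theorem finite_mulAut (V : Type u) [Group V] [Finite V] : Finite (MulAut V) :=
  Finite.of_injective (fun e : MulAut V => (e : V → V)) DFunLike.coe_injective

theorem NormallyHereditary.semidirect (hF : F.IsFormation) (hh : F.NormallyHereditary)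
    {V : Type u} [Group V] {S T : Subgroup (MulAut V)} (h : S ≤ T) [hn : (S.subgroupOf T).Normal]
    (hT : F (V ⋊[T.subtype] T)) : F (V ⋊[S.subtype] S) := by
  have := hF.finite _ hT
  exact hF.of_equiv (semidirectRestrict h) (hh _ _ hT)

theorem NormallyHereditary.of_semidirect (hF : F.IsFormation) (hh : F.NormallyHereditary)
    {V G : Type u} [Group V] [Group G] {φ : G →* MulAut V} (h : F (V ⋊[φ] G)) : F V := by
  have := hF.finite _ h
  exact hF.of_equiv (((MulEquiv.subgroupCongr range_inl_eq_ker_rightHom).symm).trans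
    (MonoidHom.ofInjective (inl_injective (φ := φ))).symm)
    (hh _ (rightHom : V ⋊[φ] G →* G).ker h)

theorem normal_subgroupOf_of_map {G V : Type u} [Group G] [Group V] (φ : G →* MulAut V)
    (N : Subgroup G) [hN : N.Normal] : ((N.map φ).subgroupOf φ.range).Normal := by
  constructor
  rintro ⟨_, g, rfl⟩ ⟨m, hm, h⟩ ⟨_, a, rfl⟩
  have h' : φ m = φ g := h
  exact ⟨a * m * a⁻¹, hN.conj_mem _ hm _, by simp [h']⟩

theorem NormallyHereditary.central_restrict (hF : F.IsFormation) (hh : F.NormallyHereditary)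
    {V G : Type u} [Group V] [Group G] {φ : G →* MulAut V} (N : Subgroup G) [N.Normal]
    (h : F.Central φ) : F.Central (φ.comp N.subtype) := by
  have hr : (φ.comp N.subtype).range = N.map φ := by
    rw [MonoidHom.range_comp, Subgroup.range_subtype]
  have := normal_subgroupOf_of_map φ N
  unfold Central
  rw [hr]
  exact hh.semidirect hF (Subgroup.map_le_range φ N) h

theorem card_quotient_lt {G : Type u} [Group G] [Finite G] {W : Subgroup G} (hW : W ≠ ⊥) :
    Nat.card (G ⧸ W) < Nat.card G := by
  rw [W.card_eq_card_quotient_mul_card_subgroup]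
  exact lt_mul_of_one_lt_right Nat.card_pos (W.one_lt_card_iff_ne_bot.2 hW)

theorem jcs_of_subsingleton {G : Type u} [Group G] [Subsingleton G] : Jcs J F G := by
  refine ⟨inferInstance, fun H K _ _ hc => ?_⟩
  exact absurd hc.1 (by rw [Subsingleton.elim K H]; exact lt_irrefl _)

/-- Induction on the order of `G` through a minimal normal subgroup `W ≤ N`. Only chief factors of
`N` inside `W` remain, and these need not be all of `W`. -/
theorem Jcs.normallyHereditary (hJ : J.IsNonabelianSimple) (hF : F.IsFormation)
    (hh : F.NormallyHereditary) : (Jcs J F).NormallyHereditary := by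
  have key : ∀ n : ℕ, ∀ (G : Type u) [Group G] [Finite G] (N : Subgroup G) [N.Normal],
      Nat.card G = n → Jcs J F G → Jcs J F N := by
    intro n
    induction n using Nat.strong_induction_on with
    | _ n ih =>
    intro G _ _ N _ hn hG
    rcases eq_or_ne N ⊥ with rfl | hN
    · exact jcs_of_subsingleton
    obtain ⟨W, hWn, hWN, hW⟩ := IsChiefFactor.exists_upper (bot_lt_iff_ne_bot.2 hN)
    have hcard : Nat.card (G ⧸ W) < n := hn ▸ card_quotient_lt hW.1.ne'
    let π := QuotientGroup.mk' W
    have hπ : Function.Surjective π := QuotientGroup.mk'_surjective W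
    have hNn : (N.map π).Normal := Subgroup.Normal.map inferInstance _ hπ
    have hN' := ih _ hcard (G ⧸ W) (N.map π) rfl (hG.image hJ hF hπ)
    have hW' : Good J F (MulAut.conjNormal : G →* MulAut W) :=
      (good_bot hJ hF W).2 (((jcs_iff hF).1 hG).2 W ⊥ hW)
    refine Jcs.of_quotient hJ hF (π.subgroupMap_surjective N) hN' fun H K _ _ hc hH => ?_
    have hHW : ∀ x ∈ H, (x : G) ∈ W := by
      intro x hx
      have h1 : π x = 1 := congrArg Subtype.val (MonoidHom.mem_ker.1 (hH hx))
      exact (QuotientGroup.eq_one_iff (x : G)).1 h1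
    by_cases hFW : F W
    · have h1 := hh.central_restrict hF N (hW'.1 hFW)
      let A : Subgroup W := (H.map N.subtype).subgroupOf W
      have hA : ∀ a : A, ∃ h : H, ((h : N) : G) = (a : W) := by
        rintro ⟨a, x, hx, hxa⟩
        exact ⟨⟨x, hx⟩, hxa⟩
      let t : A →* H :=
        { toFun := fun a => ⟨⟨(a : W), hWN a.1.2⟩, by
            obtain ⟨h, hh⟩ := hA a
            have : (⟨(a : W), hWN a.1.2⟩ : N) = h := Subtype.ext hh.symm
            rw [this]; exact h.2⟩
          map_one' := rfl
          map_mul' := fun _ _ => rfl }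
      have ht : Function.Surjective t := fun h =>
        ⟨⟨⟨(h : N), hHW h h.2⟩, ⟨h, h.2, rfl⟩⟩, rfl⟩
      have hAinv : ∀ (g : N), ∀ a ∈ A,
          ((MulAut.conjNormal : G →* MulAut W).comp N.subtype) g a ∈ A := by
        rintro g a ⟨x, hx, hxa⟩
        refine ⟨g * x * g⁻¹, Subgroup.Normal.conj_mem inferInstance _ hx _, ?_⟩
        have hxa : (x : G) = a := hxa
        simp [hxa]
      have h2 : F.Central (factorConj H K) := by
        -- Since `W ≤ N`, the inner automorphisms of `W` are induced by `N`, as `central_section`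
        -- requires.
        refine hF.central_section h1 (fun v => ⟨⟨v, hWN v.2⟩, ?_⟩) A hAinv
          ((QuotientGroup.mk' (K.subgroupOf H)).comp t)
          ((QuotientGroup.mk'_surjective _).comp ht) ?_
        · ext w; simp
        · intro g a
          refine congrArg (QuotientGroup.mk (s := K.subgroupOf H)) ?_
          apply Subtype.ext
          apply Subtype.ext
          simp [t]
      exact ⟨fun _ => h2, fun h3 => absurd (hh.of_semidirect hF h2) h3⟩
    · obtain ⟨hs, hj⟩ := hW'.2 hFW
      -- Here `W` is simple, and a normal subgroup of `N` inside `W` is normal in `W`.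
      have hdich : ∀ L : Subgroup N, L.Normal → (∀ x ∈ L, (x : G) ∈ W) →
          L = ⊥ ∨ L = W.subgroupOf N := by
        intro L hL hLW
        have hLn : ((L.map N.subtype).subgroupOf W).Normal := by
          constructor
          rintro a ⟨x, hx, hxa⟩ w
          refine ⟨⟨w, hWN w.2⟩ * x * ⟨w, hWN w.2⟩⁻¹, hL.conj_mem _ hx _, ?_⟩
          have hxa : (x : G) = a := hxa
          simp [hxa]
        rcases hLn.eq_bot_or_eq_top with h1 | h1
        · left
          rw [eq_bot_iff]
          intro x hx
          have h2 : (⟨x, hLW x hx⟩ : W) ∈ (L.map N.subtype).subgroupOf W := ⟨x, hx, rfl⟩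
          rw [h1, Subgroup.mem_bot] at h2
          exact Subgroup.mem_bot.2 (Subtype.ext (congrArg (fun w : W => (w : G)) h2))
        · right
          refine le_antisymm hLW fun x hx => ?_
          have h2 : (⟨x, hx⟩ : W) ∈ (L.map N.subtype).subgroupOf W := h1 ▸ Subgroup.mem_top _
          obtain ⟨y, hy, hyx⟩ := h2
          have : y = x := Subtype.ext hyx
          exact this ▸ hy
      have hH' : H = W.subgroupOf N :=
        (hdich H inferInstance hHW).resolve_left fun h => not_lt_bot (h ▸ hc.1)
      have hK' : K = ⊥ := (hdich K inferInstance fun x hx => hHW x (hc.1.le hx)).resolve_right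
        fun h => hc.1.ne (h.trans hH'.symm)
      subst hH' hK'
      obtain ⟨e, -⟩ := exists_factor_bot_equiv (W.subgroupOf N)
      let e' : W ≃* Factor (W.subgroupOf N) ⊥ := (Subgroup.subgroupOfEquivOfLe hWN).symm.trans e
      have hj' := hJ.iso _ _ e' hj
      exact ⟨fun h => absurd ((hF.congr e').2 h) hFW, fun _ => ⟨hJ.simple _ hj', hj'⟩⟩
  exact fun G _ _ N _ hG => key _ G N rfl hG

end GroupClass

/-! ### The Fitting property -/

/-- In a group with trivial intersection of a finite family of normal subgroups, each normal
subgroup with non-abelian simple quotient contains a member of the family. -/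
theorem exists_ker_le_of_simple {W U : Type*} [Group W] [Group U] {ι : Type*} [Finite ι]
    (K : ι → Subgroup W) [∀ i, (K i).Normal] (hK : ∀ x, (∀ i, x ∈ K i) → x = 1) (g : W →* U)
    (hg : Function.Surjective g) [IsSimpleGroup U] (hU : ∃ a b : U, a * b ≠ b * a) :
    ∃ i, K i ≤ g.ker := by
  classical
  by_contra! hcon
  have key : ∀ s : Finset ι, (⨅ i ∈ s, K i).map g = ⊤ := by
    intro s
    induction s using Finset.induction_on with
    | empty => simpa using Subgroup.map_top_of_surjective g hg
    | insert a s _ ih =>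
      rw [Finset.iInf_insert]
      have hn : (⨅ i ∈ s, K i).Normal :=
        Subgroup.normal_iInf_normal fun i => Subgroup.normal_iInf_normal fun _ => inferInstance
      set D := ⨅ i ∈ s, K i
      have h1 : (K a).map g = ⊤ := by
        refine ((Subgroup.Normal.map inferInstance g hg).eq_bot_or_eq_top).resolve_left fun h => ?_
        exact hcon a ((Subgroup.map_eq_bot_iff _).1 h)
      refine ((Subgroup.Normal.map inferInstance g hg).eq_bot_or_eq_top).resolve_left fun h => ?_
      obtain ⟨x, y, hxy⟩ := hU
      apply hxy
      obtain ⟨k, hk, rfl⟩ : x ∈ (K a).map g := h1 ▸ Subgroup.mem_top x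
      obtain ⟨d, hd, rfl⟩ : y ∈ D.map g := ih ▸ Subgroup.mem_top y
      -- Both `K a` and `D` map onto `U`. Their commutators lie in the intersection, so if that had
      -- trivial image, `U` would be abelian.
      have hmem : k * d * k⁻¹ * d⁻¹ ∈ K a ⊓ D :=
        ⟨by simpa [mul_assoc] using
            (K a).mul_mem hk (Subgroup.Normal.conj_mem inferInstance _ ((K a).inv_mem hk) d),
          D.mul_mem (hn.conj_mem _ hd k) (D.inv_mem hd)⟩
      have h2 : g (k * d * k⁻¹ * d⁻¹) = 1 := by
        have : g (k * d * k⁻¹ * d⁻¹) ∈ (K a ⊓ D).map g := ⟨_, hmem, rfl⟩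
        rwa [h, Subgroup.mem_bot] at this
      simpa [mul_inv_eq_iff_eq_mul] using h2
  cases nonempty_fintype ι
  have h1 := key Finset.univ
  have h2 : (⨅ i ∈ (Finset.univ : Finset ι), K i) = ⊥ := by
    rw [eq_bot_iff]
    intro x hx
    exact hK x (by simpa [Subgroup.mem_iInf] using hx)
  rw [h2, Subgroup.map_bot] at h1
  exact bot_ne_top h1

namespace GroupClass

variable {J F : GroupClass.{u}}

/-- Inside `V ⋊ U` the preimages of `S` and `T` are normal, have product everything, and are copies
of `V ⋊ S` and `V ⋊ T`. -/
theorem Fitting.semidirect (hF : F.IsFormation) (hf : F.Fitting) {V : Type u} [Group V] [Finite V]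
    {S T U : Subgroup (MulAut V)} (hS : S ≤ U) (hT : T ≤ U) (hU : U ≤ S ⊔ T)
    [(S.subgroupOf U).Normal] [(T.subgroupOf U).Normal]
    (h₁ : F (V ⋊[S.subtype] S)) (h₂ : F (V ⋊[T.subtype] T)) : F (V ⋊[U.subtype] U) := by
  have := finite_mulAut V
  have : Finite (V ⋊[U.subtype] U) := SemidirectProduct.finite
  refine hf.2 _ ((S.subgroupOf U).comap (rightHom : V ⋊[U.subtype] U →* U))
    ((T.subgroupOf U).comap (rightHom : V ⋊[U.subtype] U →* U)) ?_
    (hF.of_equiv (semidirectRestrict hS).symm h₁) (hF.of_equiv (semidirectRestrict hT).symm h₂)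
  rw [Subgroup.comap_sup_eq _ _ _ rightHom_surjective, ← Subgroup.subgroupOf_sup hS hT,
    Subgroup.subgroupOf_eq_top.2 hU, Subgroup.comap_top]

theorem Fitting.central_sup (hF : F.IsFormation) (hf : F.Fitting) {V G : Type u} [Group V]
    [Finite V] [Group G] {φ : G →* MulAut V} (A B : Subgroup G) [A.Normal] [B.Normal]
    (hAB : A ⊔ B = ⊤) (h₁ : F.Central (φ.comp A.subtype)) (h₂ : F.Central (φ.comp B.subtype)) :
    F.Central φ := by
  have hr : ∀ N : Subgroup G, (φ.comp N.subtype).range = N.map φ := by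
    intro N
    rw [MonoidHom.range_comp, Subgroup.range_subtype]
  have := normal_subgroupOf_of_map φ A
  have := normal_subgroupOf_of_map φ B
  unfold Central at *
  rw [hr] at h₁ h₂
  refine hf.semidirect hF (Subgroup.map_le_range φ A) (Subgroup.map_le_range φ B) ?_ h₁ h₂
  rw [← Subgroup.map_sup, hAB, MonoidHom.range_eq_map]

theorem IsFormation.central_of_trivial (hF : F.IsFormation) {V G : Type u} [Group V] [Group G]
    {φ : G →* MulAut V} (hφ : ∀ g, φ g = 1) (hV : F V) : F.Central φ := by
  have : Subsingleton φ.range := by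
    constructor
    rintro ⟨_, a, rfl⟩ ⟨_, b, rfl⟩
    simp [hφ]
  refine hF.image V _ (inl : V →* V ⋊[φ.range.subtype] φ.range) (fun x => ⟨x.left, ?_⟩) hV
  exact SemidirectProduct.ext rfl (Subsingleton.elim _ _)

section

variable {G : Type u} [Group G] {W A : Subgroup G}

/-- The quotient map `W → W / K`, for normal subgroups `K ≤ W` of `A`. -/
def toFactor (hWA : W ≤ A) (K : Subgroup A) [K.Normal] : W →* Factor (W.subgroupOf A) K :=
  (QuotientGroup.mk' _).comp (Subgroup.subgroupOfEquivOfLe hWA).symm.toMonoidHom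

theorem toFactor_surjective (hWA : W ≤ A) (K : Subgroup A) [K.Normal] :
    Function.Surjective (toFactor hWA K) :=
  (QuotientGroup.mk'_surjective _).comp (MulEquiv.surjective _)

theorem toFactor_eq_one (hWA : W ≤ A) (K : Subgroup A) [K.Normal] (w : W) :
    toFactor hWA K w = 1 ↔ (⟨w, hWA w.2⟩ : A) ∈ K :=
  factor_mk_eq_one _

theorem exists_chief_top [Finite G] (hW : IsChiefFactor W ⊥) (hWA : W ≤ A) :
    ∃ (K : Subgroup A) (_ : K.Normal), IsChiefFactor (W.subgroupOf A) K := by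
  have : (⊥ : Subgroup A) < W.subgroupOf A := by
    rw [bot_lt_iff_ne_bot]
    intro h
    apply hW.1.ne'
    have := Subgroup.subgroupOf_eq_bot.1 h
    rwa [disjoint_iff, inf_eq_left.2 hWA] at this
  obtain ⟨L, hL, -, hc⟩ := IsChiefFactor.exists_lower this
  exact ⟨L, hL, hc⟩

variable [W.Normal]

theorem toFactor_conj (hWA : W ≤ A) (K : Subgroup A) [K.Normal] (a : A) (w : W) :
    toFactor hWA K (((MulAut.conjNormal : G →* MulAut W).comp A.subtype) a w) =
      factorConj (W.subgroupOf A) K a (toFactor hWA K w) := by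
  refine congrArg (QuotientGroup.mk (s := K.subgroupOf (W.subgroupOf A))) ?_
  exact Subtype.ext (Subtype.ext (by simp))

variable [A.Normal]

/-- The chief factors of `A` at the top of `W`, with quotient in a class `Q` closed under
isomorphism, have trivial intersection. -/
theorem eq_one_of_forall_mem_chief (hW : IsChiefFactor W ⊥) (hWA : W ≤ A) (Q : GroupClass.{u})
    (hQ : ∀ (V V' : Type u) [Group V] [Group V'], V ≃* V' → Q V → Q V')
    (hex : ∃ (K : Subgroup A) (_ : K.Normal), IsChiefFactor (W.subgroupOf A) K ∧
      Q (Factor (W.subgroupOf A) K)) (x : W)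
    (hx : ∀ (K : Subgroup A) [K.Normal], IsChiefFactor (W.subgroupOf A) K →
      Q (Factor (W.subgroupOf A) K) → (⟨x, hWA x.2⟩ : A) ∈ K) : x = 1 := by
  let S : Set (Subgroup A) := {K | ∃ _ : K.Normal, IsChiefFactor (W.subgroupOf A) K ∧
      Q (Factor (W.subgroupOf A) K)}
  -- Conjugation by `g` is an automorphism of `A` preserving `W`, so `G` permutes `S`. The
  -- intersection is then normal in `G`, and minimality of `W` applies to it.
  have hS : ∀ (g : G), ∀ K ∈ S, K.comap (MulAut.conjNormal g : A ≃* A).toMonoidHom ∈ S := by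
    rintro g K ⟨hK, hc, hq⟩
    have hσ : Function.Surjective (MulAut.conjNormal g : A ≃* A).toMonoidHom :=
      MulEquiv.surjective _
    obtain ⟨e, -⟩ := exists_factor_equiv_comap hσ (W.subgroupOf A) K
    have h1 := hc.comap hσ
    have h2 := hQ _ _ e.symm hq
    have hW' : (W.subgroupOf A).comap (MulAut.conjNormal g : A ≃* A).toMonoidHom =
        W.subgroupOf A := by
      ext a
      simp only [Subgroup.mem_comap, Subgroup.mem_subgroupOf]
      change ((MulAut.conjNormal g a : A) : G) ∈ W ↔ _
      rw [MulAut.conjNormal_apply]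
      exact (Subgroup.Normal.mem_comm_iff inferInstance).trans (by simp)
    refine ⟨inferInstance, hW' ▸ h1, ?_⟩
    have key : ∀ (H : Subgroup A) [H.Normal], H = W.subgroupOf A →
      Q (Factor H (K.comap (MulAut.conjNormal g : A ≃* A).toMonoidHom)) →
      Q (Factor (W.subgroupOf A) (K.comap (MulAut.conjNormal g : A ≃* A).toMonoidHom)) := by
      rintro H _ rfl h
      exact h
    exact key _ hW' h2
  let D : Subgroup G := (sInf S).map A.subtype
  have hDn : D.Normal := by
    constructor
    rintro _ ⟨a, ha, rfl⟩ g
    refine ⟨MulAut.conjNormal g a, ?_, by simp⟩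
    refine Subgroup.mem_sInf.2 fun K hK => ?_
    exact Subgroup.mem_sInf.1 ha _ (hS g K hK)
  obtain ⟨K, hK, hc, hq⟩ := hex
  have hDK : ∀ a ∈ sInf S, a ∈ K := fun a ha => Subgroup.mem_sInf.1 ha K ⟨hK, hc, hq⟩
  have hDW : D ≤ W := by
    rintro _ ⟨a, ha, rfl⟩
    exact hc.1.le (hDK a ha)
  have hxD : (x : G) ∈ D := ⟨⟨x, hWA x.2⟩, Subgroup.mem_sInf.2 fun K ⟨_, h1, h2⟩ => hx K h1 h2, rfl⟩
  rcases hW.2 D hDn bot_le hDW with h | h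
  · rw [h, Subgroup.mem_bot] at hxD
    exact Subtype.ext hxD
  · exfalso
    refine hc.1.not_ge fun a ha => ?_
    obtain ⟨b, hb, hba⟩ : (a : G) ∈ D := h ▸ ha
    have : b = a := Subtype.ext hba
    exact hDK a (this ▸ hb)

/-- The `A`-chief quotients of `W` are images of `W`, hence in `F`, hence central; their kernels
meet trivially, so `central_of_family` applies. -/
theorem Jcs.central_restrict [Finite G] (hF : F.IsFormation) (hN : F.ContainsNilpotent)
    (hW : IsChiefFactor W ⊥) (hWA : W ≤ A) (hA : Jcs J F A) (hFW : F W) :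
    F.Central ((MulAut.conjNormal : G →* MulAut W).comp A.subtype) := by
  let ι := {K : Subgroup A // K.Normal ∧ IsChiefFactor (W.subgroupOf A) K}
  have hn : ∀ i : ι, i.1.Normal := fun i => i.2.1
  refine hF.central_of_family hN (fun i : ι => Factor (W.subgroupOf A) i.1)
    (fun i => factorConj (W.subgroupOf A) i.1) (fun i => toFactor hWA i.1)
    (fun i => toFactor_surjective hWA i.1) (fun i => toFactor_conj hWA i.1) ?_ ?_
  · intro w hw
    obtain ⟨K, hK, hc⟩ := exists_chief_top hW hWA
    refine eq_one_of_forall_mem_chief hW hWA (fun _ _ => True) (fun _ _ _ _ _ _ => trivial)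
      ⟨K, hK, hc, trivial⟩ w fun K hK hc _ => ?_
    exact (toFactor_eq_one hWA K w).1 (hw ⟨K, hK, hc⟩)
  · intro i
    exact (((jcs_iff hF).1 hA).2 _ i.1 i.2.2).1
      (hF.image _ _ (toFactor hWA i.1) (toFactor_surjective hWA i.1) hFW)

/-- Some `A`-chief quotient of `W` is outside `F`, since otherwise `W` would be a residual product
of members of `F`. The kernels of those outside `F` are again permuted by `G`, so they alone meet
trivially. -/
theorem Jcs.exists_simple_family [Finite G] (hF : F.IsFormation) (hN : F.ContainsNilpotent)
    (hW : IsChiefFactor W ⊥) (hWA : W ≤ A) (hA : Jcs J F A) (hFW : ¬ F W) :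
    ∃ S : Set (Subgroup W), S.Nonempty ∧ (∀ x, (∀ K ∈ S, x ∈ K) → x = 1) ∧
      ∀ K ∈ S, (∀ a ∈ A, ∀ x ∈ K, (MulAut.conjNormal a : W ≃* W) x ∈ K) ∧
        ∃ (V : Type u) (_ : Group V) (f : W →* V), Function.Surjective f ∧ f.ker = K ∧
          IsSimpleGroup V ∧ J V := by
  have hex : ∃ (K : Subgroup A) (_ : K.Normal), IsChiefFactor (W.subgroupOf A) K ∧
      ¬ F (Factor (W.subgroupOf A) K) := by
    by_contra hcon
    apply hFW
    let ι := {K : Subgroup A // K.Normal ∧ IsChiefFactor (W.subgroupOf A) K}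
    have hn : ∀ i : ι, i.1.Normal := fun i => i.2.1
    refine hF.of_family hN (fun i : ι => Factor (W.subgroupOf A) i.1)
      (fun i => toFactor hWA i.1) (fun i => toFactor_surjective hWA i.1) (fun i => ?_)
      fun w hw => ?_
    · by_contra h
      exact hcon ⟨i.1, i.2.1, i.2.2, h⟩
    · obtain ⟨K, hK, hc⟩ := exists_chief_top hW hWA
      refine eq_one_of_forall_mem_chief hW hWA (fun _ _ => True) (fun _ _ _ _ _ _ => trivial)
        ⟨K, hK, hc, trivial⟩ w fun K hK hc _ => ?_
      exact (toFactor_eq_one hWA K w).1 (hw ⟨K, hK, hc⟩)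
  refine ⟨{M | ∃ (K : Subgroup A) (_ : K.Normal), IsChiefFactor (W.subgroupOf A) K ∧
    ¬ F (Factor (W.subgroupOf A) K) ∧ (toFactor hWA K).ker = M}, ?_, fun x hx => ?_, ?_⟩
  · obtain ⟨K, hK, hc, hq⟩ := hex
    exact ⟨_, K, hK, hc, hq, rfl⟩
  · refine eq_one_of_forall_mem_chief hW hWA (fun V _ => ¬ F V)
      (fun V V' _ _ e h h' => h ((hF.congr e).2 h')) hex x fun K _ hc hq => ?_
    exact (toFactor_eq_one hWA K x).1 (MonoidHom.mem_ker.1 (hx _ ⟨K, _, hc, hq, rfl⟩))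
  · rintro M ⟨K, hK, hc, hq, rfl⟩
    refine ⟨fun a ha x hx => ?_, _, _, toFactor hWA K, toFactor_surjective hWA K, rfl,
      (((jcs_iff hF).1 hA).2 _ K hc).2 hq⟩
    have := toFactor_conj hWA K ⟨a, ha⟩ x
    rw [MonoidHom.mem_ker.1 hx, map_one] at this
    exact this

theorem centralizes_of_not_le (hW : IsChiefFactor W ⊥) (hWA : ¬ W ≤ A) (a : G) (ha : a ∈ A) :
    (MulAut.conjNormal a : W ≃* W) = 1 := by
  have h : W ⊓ A = ⊥ := (hW.2 (W ⊓ A) inferInstance bot_le inf_le_left).resolve_right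
    fun h => hWA (inf_eq_left.1 h)
  ext w
  have := Subgroup.commute_of_normal_of_disjoint W A inferInstance inferInstance
    (disjoint_iff.2 h) w a w.2 ha
  simp [this.symm.eq]

/-- A minimal normal subgroup outside `F` of a product of two normal subgroups from `Jcs`. -/
theorem Jcs.exists_common_simple_quotient [Finite G] (hJ : J.IsNonabelianSimple)
    (hF : F.IsFormation) (hN : F.ContainsNilpotent) {B : Subgroup G} [B.Normal] (hAB : A ⊔ B = ⊤)
    (hW : IsChiefFactor W ⊥) (hA : Jcs J F A) (hB : Jcs J F B) (hFW : ¬ F W) :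
    ∃ (V : Type u) (_ : Group V) (f : W →* V), Function.Surjective f ∧ IsSimpleGroup V ∧ J V ∧
      (∀ a ∈ A, ∀ x ∈ f.ker, (MulAut.conjNormal a : W ≃* W) x ∈ f.ker) ∧
      (∀ a ∈ B, ∀ x ∈ f.ker, (MulAut.conjNormal a : W ≃* W) x ∈ f.ker) := by
  by_cases hWA : W ≤ A
  · obtain ⟨S, hSne, hS1, hS⟩ := hA.exists_simple_family hF hN hW hWA hFW
    by_cases hWB : W ≤ B
    · obtain ⟨T, hTne, hT1, hT⟩ := hB.exists_simple_family hF hN hW hWB hFW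
      obtain ⟨M, hM⟩ := hTne
      obtain ⟨hMB, V, _, f, hf, rfl, hV, hJV⟩ := hT M hM
      have hn : ∀ i : S, (i : Subgroup W).Normal := by
        rintro ⟨K, hK⟩
        obtain ⟨-, V, _, f, hf, rfl, -⟩ := hS K hK
        infer_instance
      obtain ⟨⟨K, hK⟩, hi⟩ := exists_ker_le_of_simple (fun i : S => (i : Subgroup W))
        (fun x hx => hS1 x fun K hK => hx ⟨K, hK⟩) f hf (hJ.nonabelian V hJV)
      obtain ⟨hKA, V', _, f', hf', rfl, hV', hJV'⟩ := hS K hK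
      have hi : f'.ker ≤ f.ker := hi
      -- The quotient by `f'.ker` is simple, so a proper normal subgroup containing `f'.ker` equals
      -- it.
      have heq : f.ker = f'.ker := by
        have h1 : (f.ker.map f').Normal := Subgroup.Normal.map inferInstance _ hf'
        have h2 : (f.ker.map f').comap f' = f.ker := Subgroup.comap_map_eq_self hi
        rcases h1.eq_bot_or_eq_top with h | h
        · rw [← h2, h, MonoidHom.comap_bot]
        · exfalso
          rw [h, Subgroup.comap_top] at h2
          obtain ⟨v, hv⟩ := exists_ne (1 : V)
          obtain ⟨w, rfl⟩ := hf v
          exact hv (MonoidHom.mem_ker.1 (h2 ▸ Subgroup.mem_top w))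
      exact ⟨V, _, f, hf, hV, hJV, heq ▸ hKA, hMB⟩
    · obtain ⟨M, hM⟩ := hSne
      obtain ⟨hMA, V, _, f, hf, rfl, hV, hJV⟩ := hS M hM
      exact ⟨V, _, f, hf, hV, hJV, hMA, fun a ha x hx => by
        rwa [centralizes_of_not_le hW hWB a ha]⟩
  · by_cases hWB : W ≤ B
    · obtain ⟨T, hTne, hT1, hT⟩ := hB.exists_simple_family hF hN hW hWB hFW
      obtain ⟨M, hM⟩ := hTne
      obtain ⟨hMB, V, _, f, hf, rfl, hV, hJV⟩ := hT M hM
      exact ⟨V, _, f, hf, hV, hJV, fun a ha x hx => by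
        rwa [centralizes_of_not_le hW hWA a ha], hMB⟩
    -- If `W` lies in neither factor, both centralize it; then `W` is central in `G`, so abelian and
    -- in `F`.
    · exfalso
      have hle : (⊤ : Subgroup G) ≤ (MulAut.conjNormal : G →* MulAut W).ker :=
        hAB ▸ sup_le (centralizes_of_not_le hW hWA) (centralizes_of_not_le hW hWB)
      have hcomm : ∀ a b : W, a * b = b * a := by
        intro a b
        have h1 : (MulAut.conjNormal (a : G) : W ≃* W) = 1 := hle (Subgroup.mem_top _)
        have h2 := congrArg Subtype.val (DFunLike.congr_fun h1 b)
        rw [MulAut.conjNormal_apply] at h2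
        exact Subtype.ext (mul_inv_eq_iff_eq_mul.1 h2)
      let _ : CommGroup W := { mul_comm := hcomm }
      exact hFW (hN W inferInstance)

/-- For `W` outside `F`, the kernel of the common simple quotient is normalized by `A` and `B`,
hence normal in `G`, hence trivial by minimality of `W`. -/
theorem Jcs.good_of_sup [Finite G] (hJ : J.IsNonabelianSimple)
    (hF : F.IsFormation) (hN : F.ContainsNilpotent) (hf : F.Fitting) {B : Subgroup G} [B.Normal]
    (hAB : A ⊔ B = ⊤) (hW : IsChiefFactor W ⊥) (hA : Jcs J F A) (hB : Jcs J F B) :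
    Good J F (MulAut.conjNormal : G →* MulAut W) := by
  constructor
  · intro hFW
    have key : ∀ (C : Subgroup G) [C.Normal], Jcs J F C →
        F.Central ((MulAut.conjNormal : G →* MulAut W).comp C.subtype) := by
      intro C _ hC
      by_cases hWC : W ≤ C
      · exact hC.central_restrict hF hN hW hWC hFW
      · exact hF.central_of_trivial (fun c => centralizes_of_not_le hW hWC c c.2) hFW
    exact hf.central_sup hF A B hAB (key A hA) (key B hB)
  · intro hFW
    obtain ⟨V, _, f, hfs, hV, hJV, h1, h2⟩ :=
      Jcs.exists_common_simple_quotient hJ hF hN hAB hW hA hB hFW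
    let D : Subgroup G := f.ker.map W.subtype
    have hle : (⊤ : Subgroup G) ≤ Subgroup.normalizer (D : Set G) := by
      have key : ∀ C : Subgroup G,
          (∀ a ∈ C, ∀ x ∈ f.ker, (MulAut.conjNormal a : W ≃* W) x ∈ f.ker) →
          C ≤ Subgroup.normalizer (D : Set G) := by
        intro C hC a ha
        have h3 : ∀ b ∈ C, ∀ x ∈ D, b * x * b⁻¹ ∈ D := by
          rintro b hb _ ⟨w, hw, rfl⟩
          exact ⟨_, hC b hb w hw, by simp⟩
        refine Subgroup.mem_normalizer_iff.2 fun x => ⟨h3 a ha x, fun hx => ?_⟩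
        have := h3 a⁻¹ (C.inv_mem ha) _ hx
        simpa [mul_assoc] using this
      exact hAB ▸ sup_le (key A h1) (key B h2)
    have hDn : D.Normal := Subgroup.normalizer_eq_top_iff.1 (top_le_iff.1 hle)
    have hker : f.ker = ⊥ := by
      rcases hW.2 D hDn bot_le (Subgroup.map_subtype_le _) with h | h
      · exact (Subgroup.map_eq_bot_iff_of_injective _ W.subtype_injective).1 h
      · exfalso
        obtain ⟨v, hv⟩ := exists_ne (1 : V)
        obtain ⟨w, rfl⟩ := hfs v
        obtain ⟨w', hw', hww⟩ : (w : G) ∈ D := by rw [h]; exact w.2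
        have : w' = w := Subtype.ext hww
        exact hv (this ▸ hw')
    have e := MulEquiv.ofBijective f ⟨(MonoidHom.ker_eq_bot_iff f).1 hker, hfs⟩
    have := hJ.iso _ _ e.symm hJV
    exact ⟨hJ.simple _ this, this⟩

end

theorem Jcs.fitting (hJ : J.IsNonabelianSimple) (hF : F.IsFormation)
    (hN : F.ContainsNilpotent) (hf : F.Fitting) : (Jcs J F).Fitting := by
  refine ⟨Jcs.normallyHereditary hJ hF hf.1, ?_⟩
  have key : ∀ n : ℕ, ∀ (G : Type u) [Group G] [Finite G] (A B : Subgroup G) [A.Normal]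
      [B.Normal], Nat.card G = n → A ⊔ B = ⊤ → Jcs J F A → Jcs J F B → Jcs J F G := by
    intro n
    induction n using Nat.strong_induction_on with
    | _ n ih =>
    intro G _ _ A B _ _ hn hAB hA hB
    rcases subsingleton_or_nontrivial G with hG | hG
    · exact jcs_of_subsingleton
    obtain ⟨W, hWn, -, hW⟩ := IsChiefFactor.exists_upper (bot_lt_top (α := Subgroup G))
    let π := QuotientGroup.mk' W
    have hπ : Function.Surjective π := QuotientGroup.mk'_surjective W
    have hAn : (A.map π).Normal := Subgroup.Normal.map inferInstance _ hπ
    have hBn : (B.map π).Normal := Subgroup.Normal.map inferInstance _ hπ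
    have hq := ih _ (hn ▸ card_quotient_lt hW.1.ne') (G ⧸ W) (A.map π) (B.map π) rfl
      (by rw [← Subgroup.map_sup, hAB, Subgroup.map_top_of_surjective _ hπ])
      (hA.image hJ hF (π.subgroupMap_surjective A)) (hB.image hJ hF (π.subgroupMap_surjective B))
    exact Jcs.of_minimal hJ hF hπ hq hW (QuotientGroup.ker_mk' W)
      (Jcs.good_of_sup hJ hF hN hf hAB hW hA hB)
  exact fun G _ _ A B _ _ hAB hA hB => key _ G A B rfl hAB hA hB

end GroupClass

/-! ### Actions and Heisenberg groups -/

section Actions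

variable {B V V' : Type*} [Group B] [Group V] [Group V']

/-- The componentwise action on a product. -/
def prodAut (φ : B →* MulAut V) (ψ : B →* MulAut V') : B →* MulAut (V × V') where
  toFun b := MulEquiv.prodCongr (φ b) (ψ b)
  map_one' := by rw [map_one, map_one]; rfl
  map_mul' _ _ := by rw [map_mul, map_mul]; rfl

@[simp] theorem prodAut_apply (φ : B →* MulAut V) (ψ : B →* MulAut V') (b : B) (x : V × V') :
    prodAut φ ψ b x = (φ b x.1, ψ b x.2) := rfl

/-- The action on an invariant subgroup. -/
def restrictAut (φ : B →* MulAut V) (A : Subgroup V) (hA : ∀ g, ∀ a ∈ A, φ g a ∈ A) :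
    B →* MulAut A where
  toFun b :=
    { toFun := fun a => ⟨φ b a, hA b a a.2⟩
      invFun := fun a => ⟨φ b⁻¹ a, hA b⁻¹ a a.2⟩
      left_inv := fun a => Subtype.ext (by simp)
      right_inv := fun a => Subtype.ext (by simp)
      map_mul' := fun a a' => Subtype.ext (by simp) }
  map_one' := by ext; simp
  map_mul' _ _ := by ext; simp

@[simp] theorem restrictAut_apply_coe (φ : B →* MulAut V) (A : Subgroup V)
    (hA : ∀ g, ∀ a ∈ A, φ g a ∈ A) (b : B) (a : A) :
    (restrictAut φ A hA b a : V) = φ b a := rfl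

end Actions

/-- The Heisenberg group of a biadditive map. -/
@[ext] structure Heisenberg {V V' T : Type u} [Group V] [Group V'] [CommGroup T]
    (β : V →* V' →* T) where
  a : V
  b : V'
  c : T

namespace Heisenberg

variable {V V' T : Type u} [Group V] [Group V'] [CommGroup T] {β : V →* V' →* T}

instance : Mul (Heisenberg β) := ⟨fun x y => ⟨x.a * y.a, x.b * y.b, x.c * y.c * β x.a y.b⟩⟩
instance : One (Heisenberg β) := ⟨⟨1, 1, 1⟩⟩
instance : Inv (Heisenberg β) := ⟨fun x => ⟨x.a⁻¹, x.b⁻¹, x.c⁻¹ * β x.a x.b⟩⟩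

@[simp] theorem mul_a (x y : Heisenberg β) : (x * y).a = x.a * y.a := rfl
@[simp] theorem mul_b (x y : Heisenberg β) : (x * y).b = x.b * y.b := rfl
@[simp] theorem mul_c (x y : Heisenberg β) : (x * y).c = x.c * y.c * β x.a y.b := rfl
@[simp] theorem one_a : (1 : Heisenberg β).a = 1 := rfl
@[simp] theorem one_b : (1 : Heisenberg β).b = 1 := rfl
@[simp] theorem one_c : (1 : Heisenberg β).c = 1 := rfl

instance : Group (Heisenberg β) :=
  Group.ofLeftAxioms
    (fun x y z => by
      ext
      · exact mul_assoc _ _ _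
      · exact mul_assoc _ _ _
      · simp only [mul_c, mul_a, mul_b, map_mul, MonoidHom.mul_apply]
        have key : ∀ p q r s t w : T, p * q * r * s * (t * w) = p * (q * s * w) * (r * t) := by
          intros; simp only [mul_assoc, mul_left_comm]
          simp only [mul_comm]
        exact key _ _ _ _ _ _)
    (fun x => by ext <;> simp)
    (fun x => by
      ext
      · exact inv_mul_cancel x.a
      · exact inv_mul_cancel x.b
      · change x.c⁻¹ * β x.a x.b * x.c * β x.a⁻¹ x.b = 1
        rw [map_inv, MonoidHom.inv_apply, mul_right_comm, mul_inv_cancel_right, inv_mul_cancel])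

@[simp] theorem inv_a (x : Heisenberg β) : (x⁻¹).a = x.a⁻¹ := rfl
@[simp] theorem inv_b (x : Heisenberg β) : (x⁻¹).b = x.b⁻¹ := rfl
@[simp] theorem inv_c (x : Heisenberg β) : (x⁻¹).c = x.c⁻¹ * β x.a x.b := rfl

/-- The quotient by the central subgroup `T`. -/
def proj : Heisenberg β →* V × V' where
  toFun x := (x.a, x.b)
  map_one' := rfl
  map_mul' _ _ := rfl

theorem proj_surjective : Function.Surjective (proj : Heisenberg β →* V × V') :=
  fun x => ⟨⟨x.1, x.2, 1⟩, rfl⟩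

/-- The inclusion of the central subgroup `T`. -/
def ofCenter : T →* Heisenberg β where
  toFun t := ⟨1, 1, t⟩
  map_one' := rfl
  map_mul' _ _ := by ext <;> simp

theorem mem_ker_proj (x : Heisenberg β) : x ∈ proj.ker ↔ ofCenter x.c = x := by
  rw [MonoidHom.mem_ker]
  constructor
  · intro h
    obtain ⟨h1, h2⟩ := Prod.ext_iff.1 h
    ext
    · exact h1.symm
    · exact h2.symm
    · rfl
  · intro h
    rw [← h]
    rfl

instance [Finite V] [Finite V'] [Finite T] : Finite (Heisenberg β) :=
  Finite.of_injective (fun x => (x.a, x.b, x.c)) fun x y h => by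
    simp only [Prod.mk.injEq] at h
    exact Heisenberg.ext h.1 h.2.1 h.2.2

/-- The action of a group of operators. -/
def aut {B : Type u} [Group B] (φ : B →* MulAut V) (φ' : B →* MulAut V') (ψ : B →* MulAut T)
    (h : ∀ g v w, β (φ g v) (φ' g w) = ψ g (β v w)) : B →* MulAut (Heisenberg β) where
  toFun g :=
    { toFun := fun x => ⟨φ g x.a, φ' g x.b, ψ g x.c⟩
      invFun := fun x => ⟨φ g⁻¹ x.a, φ' g⁻¹ x.b, ψ g⁻¹ x.c⟩
      left_inv := fun x => by ext <;> simp
      right_inv := fun x => by ext <;> simp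
      map_mul' := fun x y => by ext <;> simp [h] }
  map_one' := by ext <;> simp
  map_mul' _ _ := by ext <;> simp

variable {W W' : Type u} [CommGroup W] [CommGroup W'] {γ : W →* W' →* T}

theorem isSolvable : Group.IsSolvable (Heisenberg γ) := by
  refine Group.isSolvable_of_ker_le_range (ofCenter : T →* Heisenberg γ) proj fun x hx => ?_
  exact ⟨x.c, (mem_ker_proj x).1 hx⟩

end Heisenberg

/-- If a maximal subgroup `M` misses `z`, then `G = M⟨z⟩` with `z` central. Every commutator of `G`
is then one of `M`, so `z` lies in `M` after all. -/
theorem mem_frattini_of_mem_center_of_mem_commutator {G : Type*} [Group G] {z : G}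
    (hz : z ∈ Subgroup.center G) (hc : z ∈ commutator G) : z ∈ frattini G := by
  refine Subgroup.mem_iInf.2 fun M => Subgroup.mem_iInf.2 fun hM => ?_
  by_contra hzM
  have hle : commutator G ≤ M := by
    have htop : M ⊔ Subgroup.zpowers z = ⊤ := by
      refine hM.2 _ (lt_of_le_of_ne le_sup_left fun h => hzM ?_)
      rw [h]
      exact (le_sup_right : _ ≤ M ⊔ Subgroup.zpowers z) (Subgroup.mem_zpowers z)
    have hn : (Subgroup.zpowers z).Normal := by
      constructor
      intro n hn g
      obtain ⟨k, rfl⟩ := Subgroup.mem_zpowers_iff.1 hn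
      have := Subgroup.mem_center_iff.1 ((Subgroup.center G).zpow_mem hz k) g
      rw [this]
      simp
    have hdec : ∀ g : G, ∃ m ∈ M, ∃ c ∈ Subgroup.center G, m * c = g := by
      intro g
      obtain ⟨m, hm, c, hc, h⟩ := Subgroup.mem_sup_of_normal_right.1 (htop ▸ Subgroup.mem_top g)
      exact ⟨m, hm, c, Subgroup.zpowers_le.2 hz hc, h⟩
    rw [commutator_def, Subgroup.commutator_le]
    intro x _ y _
    obtain ⟨m, hm, c, hc, rfl⟩ := hdec x
    obtain ⟨m', hm', c', hc', rfl⟩ := hdec y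
    rw [Subgroup.mem_center_iff] at hc hc'
    have h1 : m * c * (m' * c') = m * m' * (c * c') := by
      rw [mul_assoc, ← mul_assoc c, ← hc m']
      simp only [mul_assoc]
    have h2 : m' * c' * (m * c) = m' * m * (c * c') := by
      rw [mul_assoc, ← mul_assoc c', ← hc' m, mul_assoc m c' c, hc c']
      simp only [mul_assoc]
    have : ⁅m * c, m' * c'⁆ = m * m' * m⁻¹ * m'⁻¹ := by
      have h3 : ⁅m * c, m' * c'⁆ = (m * c * (m' * c')) * (m' * c' * (m * c))⁻¹ := by
        rw [commutatorElement_def]; group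
      rw [h3, h1, h2]
      group
    rw [this]
    exact M.mul_mem (M.mul_mem (M.mul_mem hm hm') (M.inv_mem hm)) (M.inv_mem hm')
  exact hzM (hle hc)

/-! ### Soluble saturation and bilinear pairings -/

namespace GroupClass

variable {F : GroupClass.{u}}

/-- The group `A ⋊ (V ⋊ G)` is in `F`, and it maps onto `V' ⋊ G` because by `hc` conjugation by `V`
is trivial on `V'`. -/
theorem IsFormation.semidirect_section (hF : F.IsFormation) {V V' G : Type u} [Group V]
    [Group V'] [Group G] {φ : G →* MulAut V} {ψ : G →* MulAut V'} (h : F (V ⋊[φ] G))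
    (A : Subgroup V) [hAn : A.Normal] (hA : ∀ g, ∀ a ∈ A, φ g a ∈ A) (f : A →* V')
    (hf : Function.Surjective f) (hψ : ∀ g (a : A), f ⟨φ g a, hA g a a.2⟩ = ψ g (f a))
    (hc : ∀ v (a : A), f ⟨v * a * v⁻¹, hAn.conj_mem _ a.2 v⟩ = f a) : F (V' ⋊[ψ] G) := by
  let D : Subgroup (V ⋊[φ] G) := A.map inl
  have hconj : ∀ (e : V ⋊[φ] G) (a : V),
      e * inl a * e⁻¹ = inl (e.left * φ e.right a * e.left⁻¹) := by
    intro e a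
    conv_lhs => rw [← inl_left_mul_inr_right e]
    rw [map_mul, map_mul, inl_aut, mul_inv_rev, map_inv, map_inv]
    group
  have hD : D.Normal := by
    constructor
    rintro _ ⟨a, ha, rfl⟩ e
    exact ⟨_, hAn.conj_mem _ (hA e.right a ha) e.left, (hconj e a).symm⟩
  let i : A ≃* D := A.equivMapOfInjective inl inl_injective
  have hi : ∀ a : A, ((i a : D) : V ⋊[φ] G) = inl (a : V) := fun a => rfl
  refine hF.semidirect_image (f.comp i.symm.toMonoidHom) (rightHom : V ⋊[φ] G →* G)
    (hf.comp i.symm.surjective) rightHom_surjective ?_ (hF.semidirect_conjNormal h D)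
  intro e d
  obtain ⟨a, rfl⟩ := i.surjective d
  have : MulAut.conjNormal e (i a) =
      i ⟨e.left * φ e.right a * e.left⁻¹, hAn.conj_mem _ (hA e.right a a.2) e.left⟩ := by
    apply Subtype.ext
    rw [MulAut.conjNormal_apply, hi, hi, hconj]
  simp [this, ← hψ]
  exact hc e.left ⟨φ e.right a, hA e.right a a.2⟩

theorem IsFormation.semidirect_prod (hF : F.IsFormation) {V V' G : Type u} [Group V]
    [Group V'] [Group G] {φ : G →* MulAut V} {ψ : G →* MulAut V'} (h : F (V ⋊[φ] G))
    (h' : F (V' ⋊[ψ] G)) : F ((V × V') ⋊[prodAut φ ψ] G) := by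
  have := hF.finite _ h
  have := hF.finite _ h'
  have : Finite V := Finite.of_injective _ (inl_injective (φ := φ))
  have : Finite V' := Finite.of_injective _ (inl_injective (φ := ψ))
  have : Finite G := Finite.of_injective _ (inr_injective (φ := ψ))
  have : Finite ((V × V') ⋊[prodAut φ ψ] G) := SemidirectProduct.finite
  refine hF.of_pair (mapPair (MonoidHom.fst V V') (MonoidHom.id G) fun _ _ => rfl)
    (mapPair (MonoidHom.snd V V') (MonoidHom.id G) fun _ _ => rfl)
    (mapPair_surjective _ Prod.fst_surjective Function.surjective_id)
    (mapPair_surjective _ Prod.snd_surjective Function.surjective_id) h h' ?_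
  rintro ⟨⟨a, b⟩, g⟩ h1 h2
  have h3 : a = 1 := congrArg SemidirectProduct.left h1
  have h4 : b = 1 := congrArg SemidirectProduct.left h2
  have h5 : g = 1 := congrArg SemidirectProduct.right h2
  subst h3 h4 h5
  rfl

theorem SolublySaturated.of_ker_le (hF : F.IsFormation) (hS : F.SolublySaturated) {E Q : Type u}
    [Group E] [Finite E] [Group Q] (f : E →* Q) (hf : Function.Surjective f) (N : Subgroup E)
    [N.Normal] (hN : Group.IsSolvable N) (hk : f.ker ≤ (frattini N).map N.subtype) (hQ : F Q) :
    F E := by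
  refine hS E N hN (hF.image _ _ (QuotientGroup.map f.ker _ (MonoidHom.id E) hk) ?_
    (hF.of_equiv (QuotientGroup.quotientKerEquivOfSurjective f hf).symm hQ))
  intro x
  induction x using QuotientGroup.induction_on with
  | H g => exact ⟨g, rfl⟩

/-- Soluble saturation passes from two modules to a module generated by their products. -/
theorem SolublySaturated.semidirect_of_pairing (hF : F.IsFormation) (hS : F.SolublySaturated)
    {B V V' T : Type u} [Group B] [CommGroup V] [CommGroup V'] [CommGroup T] [Finite T]
    {φ : B →* MulAut V} {φ' : B →* MulAut V'} {ψ : B →* MulAut T} (β : V →* V' →* T)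
    (hβ : ∀ g v w, β (φ g v) (φ' g w) = ψ g (β v w))
    (hT : Subgroup.closure {t | ∃ v w, β v w = t} = ⊤)
    (h : F (V ⋊[φ] B)) (h' : F (V' ⋊[φ'] B)) : F (T ⋊[ψ] B) := by
  have := hF.finite _ h
  have := hF.finite _ h'
  have : Finite V := Finite.of_injective _ (inl_injective (φ := φ))
  have : Finite V' := Finite.of_injective _ (inl_injective (φ := φ'))
  have : Finite B := Finite.of_injective _ (inr_injective (φ := φ))
  let θ := Heisenberg.aut φ φ' ψ hβ
  have : Finite (Heisenberg β ⋊[θ] B) := SemidirectProduct.finite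
  have hcomm : ∀ t : T, (Heisenberg.ofCenter t : Heisenberg β) ∈ commutator (Heisenberg β) := by
    have : Subgroup.closure {t | ∃ v w, β v w = t} ≤
        (commutator (Heisenberg β)).comap Heisenberg.ofCenter := by
      rw [Subgroup.closure_le]
      rintro _ ⟨v, w, rfl⟩
      have h1 : (Heisenberg.ofCenter (β v w) : Heisenberg β) =
          ⁅(⟨v, 1, 1⟩ : Heisenberg β), (⟨1, w, 1⟩ : Heisenberg β)⁆ := by
        rw [commutatorElement_def]
        ext <;> simp [Heisenberg.ofCenter]
      change _ ∈ commutator (Heisenberg β)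
      rw [h1, commutator_def]
      exact Subgroup.commutator_mem_commutator (Subgroup.mem_top _) (Subgroup.mem_top _)
    intro t
    exact this (hT ▸ Subgroup.mem_top t)
  have hcen : ∀ t : T, (Heisenberg.ofCenter t : Heisenberg β) ∈
      Subgroup.center (Heisenberg β) := by
    intro t
    rw [Subgroup.mem_center_iff]
    intro g
    ext <;> simp [Heisenberg.ofCenter, mul_comm]
  -- The kernel `T` of the map onto `(V × V') ⋊ B` is central and generated by commutators, so it
  -- lies in the Frattini subgroup of the soluble Heisenberg group.
  have hE : F (Heisenberg β ⋊[θ] B) := by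
    let N := (inl : Heisenberg β →* Heisenberg β ⋊[θ] B).range
    have hNn : N.Normal := by
      change (inl : Heisenberg β →* Heisenberg β ⋊[θ] B).range.Normal
      rw [range_inl_eq_ker_rightHom]; infer_instance
    let i : Heisenberg β ≃* N := MonoidHom.ofInjective inl_injective
    have hsol : Group.IsSolvable N := by
      have := Heisenberg.isSolvable (γ := β)
      exact Group.isSolvable_of_surjective i.surjective
    refine hS.of_ker_le hF (mapPair (ψ := prodAut φ φ') Heisenberg.proj (MonoidHom.id B)
      fun _ _ => rfl) (mapPair_surjective _ Heisenberg.proj_surjective Function.surjective_id)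
      N hsol ?_ (hF.semidirect_prod h h')
    rintro ⟨x, b⟩ hx
    have h1 : Heisenberg.proj x = 1 := congrArg SemidirectProduct.left hx
    have h2 : b = 1 := congrArg SemidirectProduct.right hx
    subst h2
    rw [← MonoidHom.mem_ker, Heisenberg.mem_ker_proj] at h1
    have h3 := mem_frattini_of_mem_center_of_mem_commutator (hcen x.c) (hcomm x.c)
    rw [h1] at h3
    exact ⟨i x, frattini_le_comap_frattini_of_surjective (φ := i.toMonoidHom) i.surjective h3, rfl⟩
  -- The twist `β x.a y.b` vanishes on this kernel, so the last coordinate is a homomorphism there.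
  let f : (Heisenberg.proj : Heisenberg β →* _).ker →* T :=
    { toFun := fun x => x.1.c
      map_one' := rfl
      map_mul' := fun x y => by
        have h1 : (x : Heisenberg β).a = 1 := congrArg Prod.fst x.2
        simp [h1] }
  refine hF.semidirect_section hE (Heisenberg.proj : Heisenberg β →* _).ker ?_ f ?_ ?_ ?_
  · intro g a ha
    rw [Heisenberg.mem_ker_proj] at ha ⊢
    rw [← ha]
    ext <;> simp [θ, Heisenberg.aut, Heisenberg.ofCenter]
  · intro t
    exact ⟨⟨Heisenberg.ofCenter t, rfl⟩, rfl⟩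
  · intro g a
    rfl
  · intro v a
    have h1 := (Heisenberg.mem_ker_proj _).1 a.2
    have h2 := Subgroup.mem_center_iff.1 (hcen (a : Heisenberg β).c) v
    rw [h1] at h2
    change (v * a * v⁻¹ : Heisenberg β).c = _
    rw [h2]
    simp only [mul_inv_cancel_right]
    rfl

end GroupClass

/-! ### Modules realized by functions on the acting group -/

theorem exists_addHom_apply_ne_zero {K A : Type*} [Field K] [AddCommGroup A] [Module K A] {a : A}
    (ha : a ≠ 0) : ∃ l : A →+ K, l a ≠ 0 := by
  by_contra! h
  exact ha ((Module.forall_dual_apply_eq_zero_iff K a).1 fun f => h f.toAddMonoidHom)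

theorem exists_hom_zmod_apply_ne_one {V : Type*} [CommGroup V] {p : ℕ} [Fact p.Prime]
    (hV : ∀ v : V, v ^ p = 1) {v : V} (hv : v ≠ 1) :
    ∃ l : V →* Multiplicative (ZMod p), l v ≠ 1 := by
  let _ : Module (ZMod p) (Additive V) := AddCommGroup.zmodModule hV
  obtain ⟨l, hl⟩ := exists_addHom_apply_ne_zero (K := ZMod p) (a := Additive.ofMul v) hv
  exact ⟨AddMonoidHom.toMultiplicativeRight l, hl⟩

section Functions

variable (B : Type*) [Group B] (p : ℕ)

/-- The left translation action on functions. -/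
def translation : B →* MulAut (Multiplicative (B → ZMod p)) where
  toFun b :=
    { toFun := fun f => Multiplicative.ofAdd fun x => f.toAdd (b⁻¹ * x)
      invFun := fun f => Multiplicative.ofAdd fun x => f.toAdd (b * x)
      left_inv := fun f => by simp
      right_inv := fun f => by simp
      map_mul' := fun _ _ => rfl }
  map_one' := by
    refine MulEquiv.ext fun f => ?_
    simp
  map_mul' b c := by
    refine MulEquiv.ext fun f => ?_
    simp [mul_assoc]

variable {B p}

@[simp] theorem translation_apply (b : B) (f : Multiplicative (B → ZMod p)) (x : B) :
    (translation B p b f).toAdd x = f.toAdd (b⁻¹ * x) := rfl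

/-- The equivariant map to functions given by a linear form. -/
def coefficient {V : Type*} [Group V] (φ : B →* MulAut V) (l : V →* Multiplicative (ZMod p)) :
    V →* Multiplicative (B → ZMod p) where
  toFun v := Multiplicative.ofAdd fun b => (l (φ b⁻¹ v)).toAdd
  map_one' := by
    ext b
    simp
  map_mul' v w := by
    ext b
    simp

@[simp] theorem coefficient_apply {V : Type*} [Group V] (φ : B →* MulAut V)
    (l : V →* Multiplicative (ZMod p)) (v : V) (b : B) :
    (coefficient φ l v).toAdd b = (l (φ b⁻¹ v)).toAdd := rfl

theorem coefficient_equivariant {V : Type*} [Group V] (φ : B →* MulAut V)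
    (l : V →* Multiplicative (ZMod p)) (b : B) (v : V) :
    coefficient φ l (φ b v) = translation B p b (coefficient φ l v) := by
  apply Multiplicative.toAdd.injective
  ext x
  simp

end Functions

namespace GroupClass

variable {F : GroupClass.{u}}

/-- The function `f` on `B` lies in the image of a `B`-module with semidirect product in `F`. -/
def Reaches (F : GroupClass.{u}) {B : Type u} [Group B] {p : ℕ} (f : B → ZMod p) : Prop :=
  ∃ (V : Type u) (_ : CommGroup V) (φ : B →* MulAut V) (j : V →* Multiplicative (B → ZMod p)),
    F (V ⋊[φ] B) ∧ (∀ b v, j (φ b v) = translation B p b (j v)) ∧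
      ∃ v, j v = Multiplicative.ofAdd f

section

variable (hF : F.IsFormation) {B : Type u} [Group B] {p : ℕ}

include hF

theorem Reaches.add {f g : B → ZMod p} (hf : F.Reaches f) (hg : F.Reaches g) :
    F.Reaches (f + g) := by
  obtain ⟨V, _, φ, j, h, hj, v, hv⟩ := hf
  obtain ⟨V', _, φ', j', h', hj', v', hv'⟩ := hg
  refine ⟨V × V', inferInstance, prodAut φ φ', j.coprod j', hF.semidirect_prod h h',
    fun b x => ?_, (v, v'), ?_⟩
  · simp [hj, hj']
  · simp [hv, hv', ofAdd_add]

theorem Reaches.const (hN : F.ContainsNilpotent) [Fact p.Prime] (hB : F B) (c : ZMod p) :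
    F.Reaches (fun _ : B => c) := by
  let j : Multiplicative (ULift.{u} (ZMod p)) →* Multiplicative (B → ZMod p) :=
    { toFun := fun v => Multiplicative.ofAdd fun _ => v.toAdd.down
      map_one' := rfl
      map_mul' := fun _ _ => rfl }
  have : Finite (Multiplicative (ULift.{u} (ZMod p))) :=
    inferInstanceAs (Finite (ULift.{u} (ZMod p)))
  refine ⟨Multiplicative (ULift.{u} (ZMod p)), inferInstance, 1, j, ?_, fun b v => rfl,
    Multiplicative.ofAdd ⟨c⟩, rfl⟩
  exact hF.of_equiv mulEquivProd.symm (hF.prod (hN _ inferInstance) hB)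

/-- Pointwise products of functions from the two images span a translation-invariant group `T`,
which replaces a tensor product. Saturation puts `T ⋊ B` in `F`. -/
theorem Reaches.mul (hS : F.SolublySaturated) [Fact p.Prime] {f g : B → ZMod p}
    (hf : F.Reaches f) (hg : F.Reaches g) : F.Reaches (f * g) := by
  obtain ⟨V, _, φ, j, h, hj, v, hv⟩ := hf
  obtain ⟨V', _, φ', j', h', hj', v', hv'⟩ := hg
  have := hF.finite _ h
  have : Finite B := Finite.of_injective _ (inr_injective (φ := φ))
  have : Finite (Multiplicative (B → ZMod p)) := inferInstanceAs (Finite (B → ZMod p))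
  let m : V → V' → Multiplicative (B → ZMod p) := fun v w =>
    Multiplicative.ofAdd ((j v).toAdd * (j' w).toAdd)
  let S : Set (Multiplicative (B → ZMod p)) := {f | ∃ v w, m v w = f}
  let T := Subgroup.closure S
  have hm : ∀ b v w, translation B p b (m v w) = m (φ b v) (φ' b w) := by
    intro b v w
    apply Multiplicative.toAdd.injective
    ext x
    simp [m, hj, hj']
  have hT : ∀ b, ∀ t ∈ T, translation B p b t ∈ T := by
    intro b
    have : T ≤ T.comap (translation B p b).toMonoidHom := by
      rw [Subgroup.closure_le]
      rintro _ ⟨v, w, rfl⟩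
      exact Subgroup.subset_closure ⟨_, _, (hm b v w).symm⟩
    exact this
  let β : V →* V' →* T := MonoidHom.mk' (fun v => MonoidHom.mk'
      (fun w => ⟨m v w, Subgroup.subset_closure ⟨v, w, rfl⟩⟩) (fun w w' => Subtype.ext (by
        simp [m, mul_add, ofAdd_add]))) (fun v v' => MonoidHom.ext fun w => Subtype.ext (by
        simp [m, add_mul, ofAdd_add]))
  have hβ : ∀ v w, (β v w : Multiplicative (B → ZMod p)) = m v w := fun _ _ => rfl
  refine ⟨T, inferInstance, restrictAut (translation B p) T hT, T.subtype,
    hS.semidirect_of_pairing hF β (fun b v w => ?_) ?_ h h', fun b t => rfl, β v v', ?_⟩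
  · apply Subtype.ext
    rw [restrictAut_apply_coe, hβ, hβ, hm]
  · have : {t : T | ∃ v w, β v w = t} = ((↑) : T → _) ⁻¹' S := by
      ext t
      simp [S, Subtype.ext_iff, hβ]
    rw [this]
    exact Subgroup.closure_closure_coe_preimage
  · simp [hβ, m, hv, hv']

/-- A finite Stone–Weierstrass argument: a subalgebra containing the constants and separating points
contains the indicator of every point. -/
theorem reaches_of_separates (hN : F.ContainsNilpotent) (hS : F.SolublySaturated) [Fact p.Prime]
    (hB : F B) (hsep : ∀ x y : B, x ≠ y → ∃ f : B → ZMod p, F.Reaches f ∧ f x ≠ f y)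
    (f : B → ZMod p) : F.Reaches f := by
  classical
  have := hF.finite _ hB
  cases nonempty_fintype B
  have hsep' : ∀ x y : B, ∃ f : B → ZMod p, F.Reaches f ∧ (x ≠ y → f x = 1 ∧ f y = 0) := by
    intro x y
    rcases eq_or_ne x y with rfl | hxy
    · exact ⟨_, Reaches.const hF hN hB 0, fun h => absurd rfl h⟩
    · obtain ⟨f, hf, hne⟩ := hsep x y hxy
      refine ⟨_, (hf.add hF (Reaches.const hF hN hB (-f y))).mul hF hS
        (Reaches.const hF hN hB (f x - f y)⁻¹), fun _ => ⟨?_, ?_⟩⟩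
      · have : f x - f y ≠ 0 := sub_ne_zero.2 hne
        simp only [Pi.mul_apply, Pi.add_apply, ← sub_eq_add_neg]
        exact mul_inv_cancel₀ this
      · simp
  choose s hs hs' using hsep'
  -- Interpolation: `s x y` is `1` at `x` and `0` at `y`, so the product over `y ≠ x` is the
  -- indicator of `x`.
  have hsum : f = ∑ x, (fun _ => f x) * ∏ y ∈ Finset.univ.erase x, s x y := by
    ext z
    rw [Finset.sum_apply, Finset.sum_eq_single z]
    · rw [Pi.mul_apply, Finset.prod_apply, Finset.prod_eq_one, mul_one]
      intro y hy
      exact (hs' z y (Finset.ne_of_mem_erase hy).symm).1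
    · intro x _ hx
      rw [Pi.mul_apply, Finset.prod_apply, Finset.prod_eq_zero (i := z), mul_zero]
      · simp [hx.symm]
      · exact (hs' x z hx).2
    · simp
  rw [hsum]
  refine Finset.sum_induction _ (fun f => F.Reaches f) (fun _ _ h h' => h.add hF h')
    (Reaches.const hF hN hB 0) fun x _ => ?_
  refine (Reaches.const hF hN hB (f x)).mul hF hS ?_
  exact Finset.prod_induction _ (fun f => F.Reaches f) (fun _ _ h h' => h.mul hF hS h')
    (Reaches.const hF hN hB 1) fun y _ => hs x y

/-- If the modules of exponent `p` with semidirect product in `F` are jointly faithful, then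
they include all irreducible ones. -/
theorem semidirect_of_irreducible (hN : F.ContainsNilpotent) (hS : F.SolublySaturated)
    [Fact p.Prime] (hB : F B)
    (hsep : ∀ b : B, b ≠ 1 → ∃ (V : Type u) (_ : CommGroup V) (φ : B →* MulAut V),
      (∀ v : V, v ^ p = 1) ∧ F (V ⋊[φ] B) ∧ φ b ≠ 1)
    {W : Type u} [CommGroup W] [Nontrivial W] (hW : ∀ w : W, w ^ p = 1) {ψ : B →* MulAut W}
    (hirr : ∀ A : Subgroup W, (∀ b, ∀ a ∈ A, ψ b a ∈ A) → A = ⊥ ∨ A = ⊤) : F (W ⋊[ψ] B) := by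
  obtain ⟨w, hw⟩ := exists_ne (1 : W)
  obtain ⟨l, hl⟩ := exists_hom_zmod_apply_ne_one hW hw
  let i := coefficient ψ l
  -- The kernel is an invariant subgroup, and it is proper because the value of `i w` at `1` is `l
  -- w`.
  have hi : Function.Injective i := by
    rw [← MonoidHom.ker_eq_bot_iff]
    refine (hirr i.ker fun b a ha => ?_).resolve_right fun h => hl ?_
    · rw [MonoidHom.mem_ker] at ha ⊢
      rw [coefficient_equivariant, ha, map_one]
    · have : i w = 1 := MonoidHom.mem_ker.1 (h ▸ Subgroup.mem_top w)
      have h1 : (i w).toAdd 1 = 0 := by rw [this]; rfl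
      simpa [i] using h1
  have hreach : F.Reaches (i w).toAdd := by
    refine reaches_of_separates hF hN hS hB (fun x y hxy => ?_) _
    have hne : y⁻¹ * x ≠ 1 := fun h => hxy (by rw [inv_mul_eq_one] at h; exact h.symm)
    obtain ⟨V, _, φ, hV, hc, hb⟩ := hsep _ hne
    have : ∃ v, φ x⁻¹ v ≠ φ y⁻¹ v := by
      by_contra! h
      apply hb
      ext v
      have := h (φ x v)
      rw [map_inv, MulAut.inv_apply_self] at this
      rw [map_mul, MulAut.mul_apply, ← this, MulAut.one_apply]
    obtain ⟨v, hv⟩ := this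
    obtain ⟨l, hl⟩ := exists_hom_zmod_apply_ne_one hV (mul_inv_eq_one.not.2 hv)
    refine ⟨(coefficient φ l v).toAdd, ⟨V, _, φ, coefficient φ l, hc,
      coefficient_equivariant φ l, v, rfl⟩, fun h => hl ?_⟩
    rw [coefficient_apply, coefficient_apply] at h
    rw [map_mul l, map_inv l, mul_inv_eq_one]
    exact Multiplicative.toAdd.injective h
  obtain ⟨V, _, φ, j, h, hj, v, hv⟩ := hreach
  -- A single nontrivial `w` is reached; irreducibility spreads this to all of `W`, making `W` a
  -- section of `V`.
  have hle : i.range ≤ j.range := by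
    have : j.range.comap i = ⊤ := by
      refine (hirr _ ?_).resolve_left fun h0 => hw ?_
      · rintro b a ⟨x, hx⟩
        exact ⟨φ b x, by rw [hj, hx, coefficient_equivariant]⟩
      · have : w ∈ j.range.comap i := ⟨v, hv⟩
        rwa [h0, Subgroup.mem_bot] at this
    rintro _ ⟨x, rfl⟩
    exact (this ▸ Subgroup.mem_top x : x ∈ j.range.comap i)
  let e : W ≃* i.range := MonoidHom.ofInjective hi
  let A : Subgroup V := i.range.comap j
  let f : A →* W := e.symm.toMonoidHom.comp (j.subgroupComap i.range)
  have hif : ∀ a : A, i (f a) = j a := fun a =>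
    congrArg Subtype.val (e.apply_symm_apply (j.subgroupComap i.range a))
  refine hF.semidirect_section h A ?_ f ?_ ?_ ?_
  · rintro b a ⟨x, hx⟩
    exact ⟨ψ b x, by rw [hj, ← hx]; exact coefficient_equivariant ψ l b x⟩
  · intro x
    obtain ⟨a, ha⟩ := hle ⟨x, rfl⟩
    refine ⟨⟨a, x, ha.symm⟩, hi ?_⟩
    rw [hif, ha]
  · intro b a
    apply hi
    rw [hif, hj, ← hif]
    exact (coefficient_equivariant ψ l b _).symm
  · intro x a
    apply hi
    rw [hif, hif]
    simp

end

end GroupClass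

/-! ### Soluble chief factors -/

section ChiefSoluble

variable {G : Type u} [Group G] {H K : Subgroup G} [H.Normal] [K.Normal]

theorem IsChiefFactor.eq_bot_or_eq_top (hc : IsChiefFactor H K) (D : Subgroup (Factor H K))
    (hD : ∀ g, ∀ v ∈ D, factorConj H K g v ∈ D) : D = ⊥ ∨ D = ⊤ := by
  let L : Subgroup G := (D.comap (QuotientGroup.mk' (K.subgroupOf H))).map H.subtype
  have hmem : ∀ h : H, (h : G) ∈ L ↔ (h : Factor H K) ∈ D := by
    intro h
    constructor
    · rintro ⟨x, hx, hxh⟩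
      have : x = h := Subtype.ext hxh
      exact this ▸ hx
    · exact fun hx => ⟨h, hx, rfl⟩
  have hL : L.Normal := by
    constructor
    rintro _ ⟨h, hh, rfl⟩ g
    exact (hmem (MulAut.conjNormal g h)).2 (hD g _ hh)
  have hKL : K ≤ L := fun k hk =>
    (hmem ⟨k, hc.1.le hk⟩).2 ((factor_mk_eq_one (⟨k, hc.1.le hk⟩ : H)).2 hk ▸ D.one_mem)
  rcases hc.2 L hL hKL (Subgroup.map_subtype_le _) with h | h
  · left
    rw [eq_bot_iff]
    intro v hv
    induction v using QuotientGroup.induction_on with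
    | H x => exact (factor_mk_eq_one x).2 (h ▸ (hmem x).2 hv)
  · right
    rw [eq_top_iff]
    intro v _
    induction v using QuotientGroup.induction_on with
    | H x => exact (hmem x).1 (by rw [h]; exact x.2)

/-- The commutator subgroup and the kernel of the `q`-th power map are invariant: solubility makes
the first proper, Cauchy's theorem makes the second nontrivial. -/
theorem IsChiefFactor.elementary_of_isSolvable [Finite G] (hc : IsChiefFactor H K)
    (hs : Group.IsSolvable H) : (∀ a b : Factor H K, a * b = b * a) ∧
      ∃ q : ℕ, q.Prime ∧ ∀ v : Factor H K, v ^ q = 1 := by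
  have hnt : Nontrivial (Factor H K) := by
    obtain ⟨x, hx, hxK⟩ := SetLike.exists_of_lt hc.1
    exact ⟨((⟨x, hx⟩ : H) : Factor H K), 1, fun h => hxK ((factor_mk_eq_one _).1 h)⟩
  have hsV : Group.IsSolvable (Factor H K) :=
    Group.isSolvable_of_surjective (QuotientGroup.mk'_surjective (K.subgroupOf H))
  have hcomm : ∀ a b : Factor H K, a * b = b * a := by
    have h1 : commutator (Factor H K) = ⊥ := by
      refine (hc.eq_bot_or_eq_top _ fun g v hv => ?_).resolve_right
        (Group.IsSolvable.commutator_lt_top_of_nontrivial _).ne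
      have := Subgroup.characteristic_iff_map_le.1
        (inferInstance : (commutator (Factor H K)).Characteristic) (factorConj H K g)
      exact this ⟨v, hv, rfl⟩
    intro a b
    have h2 : ⁅a, b⁆ ∈ commutator (Factor H K) :=
      Subgroup.commutator_mem_commutator (Subgroup.mem_top _) (Subgroup.mem_top _)
    rw [h1, Subgroup.mem_bot, commutatorElement_eq_one_iff_mul_comm] at h2
    exact h2
  refine ⟨hcomm, ?_⟩
  let _ : CommGroup (Factor H K) := { mul_comm := hcomm }
  obtain ⟨q, hq, hdvd⟩ := Nat.exists_prime_and_dvd (Finite.one_lt_card (α := Factor H K)).ne'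
  refine ⟨q, hq, ?_⟩
  have hD := hc.eq_bot_or_eq_top (powMonoidHom (α := Factor H K) q).ker fun g v hv => by
    rw [MonoidHom.mem_ker, powMonoidHom_apply] at hv ⊢
    rw [← map_pow, hv, map_one]
  have hqf : Fact q.Prime := ⟨hq⟩
  obtain ⟨x, hx⟩ := exists_prime_orderOf_dvd_card' q hdvd
  have : (powMonoidHom (α := Factor H K) q).ker = ⊤ := by
    refine hD.resolve_left fun h => ?_
    have h1 : x ∈ (powMonoidHom (α := Factor H K) q).ker := by
      rw [MonoidHom.mem_ker, powMonoidHom_apply, ← hx, pow_orderOf_eq_one]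
    rw [h, Subgroup.mem_bot] at h1
    rw [h1, orderOf_one] at hx
    exact hq.one_lt.ne hx
  intro v
  exact MonoidHom.mem_ker.1 (this ▸ Subgroup.mem_top v)

end ChiefSoluble

/-! ### Coprime action and the Frattini argument -/

section Coprime

variable {G : Type*} [Group G]

theorem eq_one_of_pow_eq_one_of_coprime {x : G} {m n : ℕ} (hm : x ^ m = 1) (hn : x ^ n = 1)
    (h : m.Coprime n) : x = 1 := by
  have := Nat.dvd_gcd (orderOf_dvd_of_pow_eq_one hm) (orderOf_dvd_of_pow_eq_one hn)
  rw [h] at this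
  exact orderOf_eq_one_iff.1 (Nat.dvd_one.1 this)

theorem IsPGroup.disjoint_of_ne_prime {p q : ℕ} (hp : p.Prime) (hq : q.Prime) (hpq : q ≠ p)
    {P Q : Subgroup G} (hP : IsPGroup p P) (hQ : IsPGroup q Q) {x : G} (hx : x ∈ P)
    (hx' : x ∈ Q) : x = 1 := by
  obtain ⟨k, hk⟩ := hP ⟨x, hx⟩
  obtain ⟨l, hl⟩ := hQ ⟨x, hx'⟩
  have hk : x ^ p ^ k = 1 := congrArg Subtype.val hk
  have hl : x ^ q ^ l = 1 := congrArg Subtype.val hl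
  exact eq_one_of_pow_eq_one_of_coprime hk hl
    (Nat.Coprime.pow _ _ ((Nat.coprime_primes hp hq).2 hpq.symm))

/-- With `z` the commutator, `n * α * n⁻¹ = α * z`. Modulo `M` the factors commute, so `z ^ m = 1`
there; also `z ^ p = 1`. -/
theorem commutator_mem_of_coprime {L M : Subgroup G} [M.Normal] {m p : ℕ} (hmp : m.Coprime p)
    {α n : G} (hα : α ^ m = 1) (hL : ∀ l ∈ L, l ^ p ∈ M)
    (hc : ∀ l ∈ L, α * l * α⁻¹ * l⁻¹ ∈ M) (hn : α⁻¹ * n * α * n⁻¹ ∈ L) :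
    α⁻¹ * n * α * n⁻¹ ∈ M := by
  set z := α⁻¹ * n * α * n⁻¹ with hz
  have h1 : n * α * n⁻¹ = α * z := by rw [hz]; group
  have hcomm : Commute (α : G ⧸ M) (z : G ⧸ M) := by
    have := (QuotientGroup.eq_one_iff _).2 (hc z hn)
    simp only [QuotientGroup.mk_mul, QuotientGroup.mk_inv] at this
    rwa [mul_inv_eq_one, mul_inv_eq_iff_eq_mul] at this
  have h2 : (α * z) ^ m = 1 := by rw [← h1, conj_pow, hα]; simp
  have h3 : (z : G ⧸ M) ^ m = 1 := by
    have := congrArg (QuotientGroup.mk (s := M)) h2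
    rw [QuotientGroup.mk_pow, QuotientGroup.mk_mul, hcomm.mul_pow, ← QuotientGroup.mk_pow, hα] at this
    simpa using this
  have h4 : (z : G ⧸ M) ^ p = 1 := by
    rw [← QuotientGroup.mk_pow]
    exact (QuotientGroup.eq_one_iff _).2 (hL z hn)
  exact (QuotientGroup.eq_one_iff _).1 (eq_one_of_pow_eq_one_of_coprime h3 h4 hmp)

/-- Let `P` be a Sylow subgroup containing `D`. If `w * d` is in `P`, then `w` lies in a `p`-group
and a `q`-group, so `P` adds nothing to `D`. -/
theorem exists_sylow_map_eq [Finite G] {p q : ℕ} (hp : p.Prime) [hq : Fact q.Prime] (hpq : q ≠ p)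
    {W D X : Subgroup G} [W.Normal] (hW : IsPGroup p W) (hD : IsPGroup q D) (hX : W ⊔ D = X) :
    ∃ P : Sylow q X, (P : Subgroup X).map X.subtype = D := by
  have hDX : D ≤ X := hX ▸ le_sup_right
  have hD' : IsPGroup q (D.subgroupOf X) := hD.of_equiv (Subgroup.subgroupOfEquivOfLe hDX).symm
  obtain ⟨P, hP⟩ := hD'.exists_le_sylow
  refine ⟨P, le_antisymm ?_ ?_⟩
  · rintro _ ⟨x, hx, rfl⟩
    obtain ⟨w, hw, d, hd, hwd⟩ := Subgroup.mem_sup_of_normal_left.1 (hX ▸ x.2 : (x : G) ∈ W ⊔ D)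
    have hwX : w ∈ X := hX ▸ Subgroup.mem_sup_left hw
    have hwP : (⟨w, hwX⟩ : X) ∈ (P : Subgroup X) := by
      have : (⟨w, hwX⟩ : X) = x * ⟨d, hDX hd⟩⁻¹ := Subtype.ext (by simp [← hwd])
      rw [this]
      exact mul_mem hx (inv_mem (hP (show (⟨d, hDX hd⟩ : X) ∈ D.subgroupOf X from hd)))
    have : w = 1 := hW.disjoint_of_ne_prime hp hq.1 hpq (P.isPGroup'.map X.subtype) hw
      ⟨_, hwP, rfl⟩
    change (x : G) ∈ D
    rw [← hwd, this, one_mul]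
    exact hd
  · intro d hd
    exact ⟨⟨d, hDX hd⟩, hP (show (⟨d, hDX hd⟩ : X) ∈ D.subgroupOf X from hd), rfl⟩

/-- The Frattini argument for a complement `D` of a normal subgroup `W` in `W ⊔ D`. -/
theorem exists_conj_mem_of_sup_invariant [Finite G] {p q : ℕ} (hp : p.Prime) [hq : Fact q.Prime]
    (hpq : q ≠ p) {W D : Subgroup G} [W.Normal] (hW : IsPGroup p W) (hD : IsPGroup q D) {n : G}
    (hn : ∀ d ∈ D, n * d * n⁻¹ ∈ W ⊔ D) :
    ∃ w ∈ W, ∀ d ∈ D, (w * n) * d * (w * n)⁻¹ ∈ D := by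
  let D' : Subgroup G := D.map (MulAut.conj n).toMonoidHom
  have hD' : IsPGroup q D' := hD.map _
  have hX : W ⊔ D' = W ⊔ D := by
    have hle : W ⊔ D' ≤ W ⊔ D := by
      refine sup_le le_sup_left ?_
      rintro _ ⟨d, hd, rfl⟩
      exact hn d hd
    have hge : (W ⊔ D).map (MulAut.conj n).toMonoidHom ≤ W ⊔ D' := by
      rw [Subgroup.map_sup]
      refine sup_le_sup_right ?_ _
      rintro _ ⟨w, hw, rfl⟩
      exact Subgroup.Normal.conj_mem inferInstance w hw n
    refine Subgroup.eq_of_le_of_card_ge hle ?_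
    rw [Nat.card_congr
      ((W ⊔ D).equivMapOfInjective (MulAut.conj n).toMonoidHom (MulAut.conj n).injective).toEquiv]
    exact Subgroup.card_le_of_le hge
  obtain ⟨P, hP⟩ := exists_sylow_map_eq hp hpq hW hD rfl
  obtain ⟨P', hP'⟩ := exists_sylow_map_eq hp hpq hW hD' hX
  -- Both `D` and its conjugate by `n` are Sylow in `W ⊔ D`. Writing the conjugating element as `d *
  -- w`, the part `d` normalizes `D` and may be dropped.
  obtain ⟨x, hx⟩ := MulAction.exists_smul_eq (W ⊔ D : Subgroup G) P' P
  obtain ⟨d, hd, w, hw, hdw⟩ := Subgroup.mem_sup_of_normal_right.1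
    (sup_comm W D ▸ x.2 : (x : G) ∈ D ⊔ W)
  refine ⟨w, hw, fun e he => ?_⟩
  have h1 : n * e * n⁻¹ ∈ (P' : Subgroup _).map (W ⊔ D).subtype := hP' ▸ ⟨e, he, rfl⟩
  obtain ⟨y, hy, hye⟩ := h1
  have h2 : x * y * x⁻¹ ∈ (P : Subgroup _) := by
    rw [← hx]
    exact ⟨y, hy, rfl⟩
  have h3 : (x : G) * (n * e * n⁻¹) * (x : G)⁻¹ ∈ D := by
    exact hP.le ⟨_, h2, by simp [← hye]⟩
  rw [← hdw] at h3
  have h4 := D.mul_mem (D.mul_mem (D.inv_mem hd) h3) hd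
  convert h4 using 1
  group

/-- Take a Sylow `q`-subgroup `D` of `X`: the index of `W ⊔ D` divides both a power of `q` and the
index of `D`, which is prime to `q`. -/
theorem exists_isPGroup_sup_eq [Finite G] {q : ℕ} [hq : Fact q.Prime] {W X : Subgroup G}
    [W.Normal] (hWX : W ≤ X) (hX : ∀ x ∈ X, x ^ q ∈ W) :
    ∃ D : Subgroup G, IsPGroup q D ∧ W ⊔ D = X := by
  obtain ⟨P⟩ : Nonempty (Sylow q X) := inferInstance
  let D : Subgroup G := (P : Subgroup X).map X.subtype
  have hDX : D ≤ X := Subgroup.map_subtype_le _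
  refine ⟨D, P.isPGroup'.map _, le_antisymm (sup_le hWX hDX) ?_⟩
  rw [← Subgroup.relIndex_eq_one]
  have h1 : (W ⊔ D).relIndex X ∣ W.relIndex X := Subgroup.relIndex_dvd_of_le_left X le_sup_left
  have h2 : (W ⊔ D).relIndex X ∣ D.relIndex X := Subgroup.relIndex_dvd_of_le_left X le_sup_right
  have hpg : IsPGroup q (X ⧸ W.subgroupOf X) := by
    intro v
    induction v using QuotientGroup.induction_on with
    | H x =>
      refine ⟨1, ?_⟩
      rw [pow_one, ← QuotientGroup.mk_pow, QuotientGroup.eq_one_iff]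
      exact hX x x.2
  obtain ⟨k, hk⟩ := IsPGroup.iff_card.1 hpg
  have hk' : W.relIndex X = q ^ k := hk
  have h3 : D.relIndex X = (P : Subgroup X).index := by
    rw [Subgroup.relIndex]
    congr 1
    exact Subgroup.comap_map_eq_self_of_injective X.subtype_injective _
  rw [hk'] at h1
  rw [h3] at h2
  have hcop : (q ^ k).Coprime (P : Subgroup X).index :=
    ((Nat.Prime.coprime_iff_not_dvd hq.1).2 P.not_dvd_index).pow_left k
  exact Nat.eq_one_of_dvd_coprimes hcop h1 h2

end Coprime

/-! ### Centralizers of Frattini chief factors -/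

section FrattiniFactor

variable {G : Type u} [Group G]

theorem pow_mem_of_factor_pow {H K : Subgroup G} [K.Normal] {q : ℕ}
    (hq : ∀ v : Factor H K, v ^ q = 1) : ∀ h ∈ H, h ^ q ∈ K := fun h hh =>
  (factor_mk_eq_one (⟨h, hh⟩ ^ q : H)).1 (by rw [QuotientGroup.mk_pow]; exact hq _)

theorem isPGroup_of_pow_mem {p : ℕ} {X L : Subgroup G} (hL : IsPGroup p L)
    (h : ∀ x ∈ X, x ^ p ∈ L) : IsPGroup p X := by
  rintro ⟨x, hx⟩
  obtain ⟨k, hk⟩ := hL ⟨_, h x hx⟩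
  have hk : (x ^ p) ^ p ^ k = 1 := congrArg Subtype.val hk
  refine ⟨k + 1, Subtype.ext ?_⟩
  change x ^ p ^ (k + 1) = 1
  rw [pow_succ', pow_mul, hk]

theorem isSolvable_of_le {H N : Subgroup G} (hN : Group.IsSolvable N) (h : H ≤ N) :
    Group.IsSolvable H :=
  Group.isSolvable_of_isSolvable_injective (Subgroup.inclusion_injective h)

variable [Finite G]

theorem conj_mem_of_forall_mem {D : Subgroup G} {g : G} (h : ∀ d ∈ D, g * d * g⁻¹ ∈ D) :
    g ∈ Subgroup.normalizer (D : Set G) :=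
  Subgroup.mem_normalizer_fintype h

/-- An element of order prime to `p` that centralizes the `p`-chief factors between `Y` and `W`
and acts trivially on `N` modulo `Y` acts trivially on `N` modulo `W`. -/
theorem commutator_mem_of_chief {W Y : Subgroup G} [hWn : W.Normal] [hYn : Y.Normal]
    (hWY : W ≤ Y) {p m : ℕ} (hmp : m.Coprime p) {α : G} (hα : α ^ m = 1)
    (hp : ∀ H K : Subgroup G, H.Normal → K.Normal → IsChiefFactor H K → W ≤ K → H ≤ Y →
      (∀ h ∈ H, h ^ p ∈ K) ∧ ∀ h ∈ H, α * h * α⁻¹ * h⁻¹ ∈ K)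
    {N : Set G} (hN : ∀ n ∈ N, α⁻¹ * n * α * n⁻¹ ∈ Y) : ∀ n ∈ N, α⁻¹ * n * α * n⁻¹ ∈ W := by
  have hfin : {L : Subgroup G | L.Normal ∧ W ≤ L ∧ L ≤ Y ∧
      ∀ n ∈ N, α⁻¹ * n * α * n⁻¹ ∈ L}.Finite := Set.toFinite _
  -- A minimal `L` absorbing all the commutators must be `W`, since coprime action pushes them
  -- through a chief factor at the top of `L`.
  obtain ⟨L, ⟨hLn, hWL, hLY, hL⟩, hmin⟩ := hfin.exists_minimal ⟨Y, hYn, hWY, le_rfl, hN⟩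
  rcases hWL.eq_or_lt with rfl | hlt
  · exact hL
  · exfalso
    obtain ⟨M, hMn, hWM, hc⟩ := IsChiefFactor.exists_lower hlt
    obtain ⟨h1, h2⟩ := hp L M hLn hMn hc hWM hLY
    exact hc.1.not_ge (hmin ⟨hMn, hWM, hc.1.le.trans hLY, fun n hn =>
      commutator_mem_of_coprime hmp hα h1 h2 (hL n hn)⟩ hc.1.le)

theorem pow_mem_of_chief_of_isPGroup {p : ℕ} (hp : p.Prime) {Y H K : Subgroup G} [H.Normal] [K.Normal]
    (hY : IsPGroup p Y) (hHN : Group.IsSolvable H) (hHY : H ≤ Y)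
    (hc : IsChiefFactor H K) : ∀ h ∈ H, h ^ p ∈ K := by
  obtain ⟨-, q, hq, hexp⟩ := hc.elementary_of_isSolvable hHN
  have hpow : ∀ h ∈ H, h ^ q ∈ K := fun h hh =>
    pow_mem_of_factor_pow hexp h hh
  rcases eq_or_ne q p with rfl | hqp
  · exact hpow
  · exfalso
    obtain ⟨x, hx, hxK⟩ := SetLike.exists_of_lt hc.1
    obtain ⟨k, hk⟩ := hY ⟨x, hHY hx⟩
    have hk : x ^ p ^ k = 1 := congrArg Subtype.val hk
    refine hxK ((QuotientGroup.eq_one_iff x).1 ?_)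
    refine eq_one_of_pow_eq_one_of_coprime (m := p ^ k) (n := q) ?_ ?_
      (((Nat.coprime_primes hp hq).2 hqp.symm).pow_left k)
    · rw [← QuotientGroup.mk_pow, hk]; rfl
    · rw [← QuotientGroup.mk_pow]
      exact (QuotientGroup.eq_one_iff _).2 (hpow x hx)

variable {p : ℕ} {N W R : Subgroup G} [W.Normal]

/-- By the Frattini argument `N` lies in the product of `W` and the normalizer of `D`; `hΦ`, which
expresses `W ≤ Φ(N)`, discards `W`. -/
theorem normalizes_of_sup_invariant (hp : p.Prime) {q : ℕ} (hq : q.Prime) (hpq : q ≠ p)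
    (hWp : IsPGroup p W)
    (hΦ : ∀ M : Subgroup G, N ≤ W ⊔ M → N ≤ M) {D : Subgroup G} (hD : IsPGroup q D)
    (hND : ∀ n ∈ N, ∀ d ∈ D, n * d * n⁻¹ ∈ W ⊔ D) :
    ∀ n ∈ N, ∀ d ∈ D, n * d * n⁻¹ ∈ D := by
  have : Fact q.Prime := ⟨hq⟩
  have hle : N ≤ Subgroup.normalizer (D : Set G) := by
    refine hΦ _ fun n hn => ?_
    obtain ⟨w, hw, h⟩ := exists_conj_mem_of_sup_invariant hp hpq hWp hD (hND n hn)
    have := Subgroup.mul_mem_sup (W.inv_mem hw) (conj_mem_of_forall_mem h)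
    simpa using this
  intro n hn d hd
  exact (Subgroup.mem_normalizer_iff.1 (hle hn) d).1 hd

/-- Each `g` normalizes `D` up to a factor in `W`, and `W ≤ N` normalizes `D`. So `D` is a normal
`q`-subgroup of `G`, which `hO` excludes unless trivial. -/
theorem eq_bot_of_sup_normal (hp : p.Prime) {q : ℕ} (hq : q.Prime) (hpq : q ≠ p)
    (hWN : W ≤ N) (hWp : IsPGroup p W) (hΦ : ∀ M : Subgroup G, N ≤ W ⊔ M → N ≤ M)
    (hO : ∀ q : ℕ, q.Prime → q ≠ p → ∀ Q : Subgroup G, Q.Normal → Q ≤ N → IsPGroup q Q → Q = ⊥)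
    {D : Subgroup G} (hD : IsPGroup q D) (hDN : D ≤ N)
    (hn : ∀ g : G, ∀ d ∈ D, g * d * g⁻¹ ∈ W ⊔ D) : D = ⊥ := by
  have : Fact q.Prime := ⟨hq⟩
  have h1 := normalizes_of_sup_invariant hp hq hpq hWp hΦ hD fun n _ => hn n
  refine hO q hq hpq D ⟨fun d hd g => ?_⟩ hDN hD
  obtain ⟨w, hw, h⟩ := exists_conj_mem_of_sup_invariant hp hpq hWp hD (hn g)
  have h2 := h1 w⁻¹ (N.inv_mem (hWN hw)) _ (h d hd)
  convert h2 using 1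
  group

variable [N.Normal] [R.Normal]

/-- The part in `N` of a normal subgroup centralizing the `p`-chief factors of `N / W`. -/
theorem isPGroup_inf_of_centralizes (hp : p.Prime) (hN : Group.IsSolvable N) (hWN : W ≤ N)
    (hWR : W ≤ R) (hWp : IsPGroup p W) (hΦ : ∀ M : Subgroup G, N ≤ W ⊔ M → N ≤ M)
    (hO : ∀ q : ℕ, q.Prime → q ≠ p → ∀ Q : Subgroup G, Q.Normal → Q ≤ N → IsPGroup q Q → Q = ⊥)
    (hR : ∀ H K : Subgroup G, H.Normal → K.Normal → IsChiefFactor H K → W ≤ K → H ≤ N →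
      (∀ h ∈ H, h ^ p ∈ K) → ∀ r ∈ R, ∀ h ∈ H, r * h * r⁻¹ * h⁻¹ ∈ K) :
    IsPGroup p (R ⊓ N : Subgroup G) := by
  have hfin : {L : Subgroup G | L.Normal ∧ W ≤ L ∧ L ≤ R ⊓ N ∧ IsPGroup p L}.Finite :=
    Set.toFinite _
  obtain ⟨L, ⟨hLn, hWL, hLY, hL⟩, hmax⟩ :=
    hfin.exists_maximal ⟨W, inferInstance, le_rfl, le_inf hWR hWN, hWp⟩
  rcases hLY.eq_or_lt with h | hlt
  · exact h ▸ hL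
  exfalso
  obtain ⟨X, hXn, hXY, hc⟩ := IsChiefFactor.exists_upper hlt
  obtain ⟨-, q, hq, hexp⟩ := hc.elementary_of_isSolvable
    (isSolvable_of_le hN (hXY.trans inf_le_right))
  have hpow : ∀ x ∈ X, x ^ q ∈ L := fun x hx =>
    pow_mem_of_factor_pow hexp x hx
  rcases eq_or_ne q p with rfl | hqp
  · exact hc.1.not_ge
      (hmax ⟨hXn, hWL.trans hc.1.le, hXY, isPGroup_of_pow_mem hL hpow⟩ hc.1.le)
  have hqf : Fact q.Prime := ⟨hq⟩
  obtain ⟨D, hD, hLD⟩ := exists_isPGroup_sup_eq hc.1.le hpow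
  have hDX : D ≤ X := hLD ▸ le_sup_right
  -- The `q`-group `D ≤ R` centralizes the chief factors between `W` and `L`, which are `p`-groups,
  -- so commutators of `L` with `D` lie in `W`.
  have hLDW : ∀ l ∈ L, ∀ d ∈ D, l * d * l⁻¹ ∈ W ⊔ D := by
    intro l hl d hd
    obtain ⟨k, hk⟩ := hD ⟨d, hd⟩
    have hk : d ^ q ^ k = 1 := congrArg Subtype.val hk
    have h1 := commutator_mem_of_chief hWL (((Nat.coprime_primes hq hp).2 hqp).pow_left k) hk
      (fun H K hH hK hc' hWK hHL => by
        have h2 := pow_mem_of_chief_of_isPGroup hp hL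
          (isSolvable_of_le hN (hHL.trans (hLY.trans inf_le_right))) hHL hc'
        exact ⟨h2, hR H K hH hK hc' hWK (hHL.trans (hLY.trans inf_le_right)) h2 d
          (hXY (hDX hd)).1⟩)
      (N := L) (fun n hn => by
        have := hLn.conj_mem n hn d⁻¹
        rw [inv_inv] at this
        exact L.mul_mem this (L.inv_mem hn)) l hl
    have h3 : l * d * l⁻¹ = d * (d⁻¹ * l * d * l⁻¹) := by group
    rw [h3]
    exact (W ⊔ D).mul_mem (le_sup_right (α := Subgroup G) hd) (le_sup_left (α := Subgroup G) h1)
  -- The Frattini argument in `L ⊔ D` makes some `l * g` normalize `D`; the factor `l` is undone by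
  -- `hLDW`.
  have hconj : ∀ g : G, ∀ d ∈ D, g * d * g⁻¹ ∈ W ⊔ D := by
    intro g d hd
    obtain ⟨l, hl, h⟩ := exists_conj_mem_of_sup_invariant (n := g) hp hqp hL hD fun d hd => by
      rw [hLD]; exact hXn.conj_mem d (hDX hd) g
    have h2 := hLDW l⁻¹ (L.inv_mem hl) _ (h d hd)
    convert h2 using 1
    group
  have hbot := eq_bot_of_sup_normal hp hq hqp hWN hWp hΦ hO hD
    (hDX.trans (hXY.trans inf_le_right)) hconj
  rw [hbot, sup_bot_eq] at hLD
  exact hc.1.ne hLD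

/-- A minimal normal `p`-subgroup `W` inside the Frattini subgroup of the soluble normal subgroup
`N` is centralized by the elements centralizing the `p`-chief factors of `N / W`. -/
theorem centralizes_frattini_factor (hp : p.Prime) (hN : Group.IsSolvable N) (hWN : W ≤ N)
    (hW : IsChiefFactor W ⊥)
    (hWR : W ≤ R) (hWp : IsPGroup p W) (hΦ : ∀ M : Subgroup G, N ≤ W ⊔ M → N ≤ M)
    (hO : ∀ q : ℕ, q.Prime → q ≠ p → ∀ Q : Subgroup G, Q.Normal → Q ≤ N → IsPGroup q Q → Q = ⊥)
    (hR : ∀ H K : Subgroup G, H.Normal → K.Normal → IsChiefFactor H K → W ≤ K → H ≤ N →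
      (∀ h ∈ H, h ^ p ∈ K) → ∀ r ∈ R, ∀ h ∈ H, r * h * r⁻¹ * h⁻¹ ∈ K) :
    R ≤ (MulAut.conjNormal : G →* MulAut W).ker := by
  have hY := isPGroup_inf_of_centralizes hp hN hWN hWR hWp hΦ hO hR
  -- Commutators of `α` with `N` lie in the `p`-group `R ∩ N`, and coprime action pushes them into
  -- `W`. Hence `N` normalizes `⟨α⟩`, and commutators with `W` lie in `W ∩ ⟨α⟩ = 1`.
  have hcoprime : ∀ q : ℕ, q.Prime → q ≠ p → ∀ α ∈ R, ∀ k : ℕ, α ^ q ^ k = 1 →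
      (MulAut.conjNormal α : W ≃* W) = 1 := by
    intro q hq hqp α hα k hk
    have h1 := commutator_mem_of_chief (le_inf hWR hWN)
      (((Nat.coprime_primes hq hp).2 hqp).pow_left k) hk
      (fun H K hH hK hc' hWK hHL => by
        have h2 := pow_mem_of_chief_of_isPGroup hp hY
          (isSolvable_of_le hN (hHL.trans inf_le_right)) hHL hc'
        exact ⟨h2, hR H K hH hK hc' hWK (hHL.trans inf_le_right) h2 α hα⟩)
      (N := N) (fun n hn => by
        constructor
        · have h2 : α⁻¹ * n * α * n⁻¹ = α⁻¹ * (n * α * n⁻¹) := by group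
          rw [h2]
          exact R.mul_mem (R.inv_mem hα) (Subgroup.Normal.conj_mem inferInstance α hα n)
        · have h2 := Subgroup.Normal.conj_mem (inferInstance : N.Normal) n hn α⁻¹
          rw [inv_inv] at h2
          exact N.mul_mem h2 (N.inv_mem hn))
    let D := Subgroup.zpowers α
    have hD : IsPGroup q D := by
      rintro ⟨_, j, rfl⟩
      refine ⟨k, Subtype.ext ?_⟩
      change (α ^ j) ^ q ^ k = 1
      rw [← zpow_natCast, zpow_comm, zpow_natCast, hk, one_zpow]
    have hND : ∀ n ∈ N, ∀ d ∈ D, n * d * n⁻¹ ∈ W ⊔ D := by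
      rintro n hn _ ⟨j, rfl⟩
      have h3 : n * α ^ j * n⁻¹ = (α * (α⁻¹ * n * α * n⁻¹)) ^ j := by
        rw [← conj_zpow]; group
      change n * α ^ j * n⁻¹ ∈ W ⊔ D
      rw [h3]
      exact (W ⊔ D).zpow_mem ((W ⊔ D).mul_mem
        (le_sup_right (α := Subgroup G) (Subgroup.mem_zpowers α))
        (le_sup_left (α := Subgroup G) (h1 n hn))) j
    have h4 := normalizes_of_sup_invariant hp hq hqp hWp hΦ hD hND
    ext w
    have h5 : α⁻¹ * (w * α * (w : G)⁻¹) ∈ D :=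
      D.mul_mem (D.inv_mem (Subgroup.mem_zpowers α)) (h4 w (hWN w.2) α (Subgroup.mem_zpowers α))
    have h6 : α⁻¹ * (w * α * (w : G)⁻¹) ∈ W := by
      have h2 := Subgroup.Normal.conj_mem (inferInstance : W.Normal) w w.2 α⁻¹
      rw [inv_inv] at h2
      have := W.mul_mem h2 (W.inv_mem w.2)
      convert this using 1
      group
    have h7 := hWp.disjoint_of_ne_prime hp hq hqp hD h6 h5
    have h8 : (w : G) * α = α * w := by
      rw [inv_mul_eq_one, eq_mul_inv_iff_mul_eq] at h7
      exact h7.symm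
    simp [← h8]
  let φ : G →* MulAut W := MulAut.conjNormal
  have hpf : Fact p.Prime := ⟨hp⟩
  have hfa := GroupClass.finite_mulAut W
  have hS : IsPGroup p (R.map φ) := by
    refine IsPGroup.of_card (Nat.eq_prime_pow_of_unique_prime_dvd Nat.card_pos.ne' ?_)
    intro q hq hdvd
    by_contra hqp
    have : Fact q.Prime := ⟨hq⟩
    obtain ⟨⟨s, hsR⟩, hs⟩ := exists_prime_orderOf_dvd_card' q hdvd
    rw [Subgroup.orderOf_mk] at hs
    obtain ⟨r, hr, rfl⟩ := hsR
    obtain ⟨e, m, hm, hrm⟩ :=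
      Nat.exists_eq_pow_mul_and_not_dvd (orderOf_pos r).ne' q hq.one_lt.ne'
    -- The power `r ^ m` is the `q`-part of `r` and acts trivially, so the order `q` of the
    -- automorphism would divide `m`.
    have h1 := hcoprime q hq hqp (r ^ m) (R.pow_mem hr m) e (by
      rw [← pow_mul, mul_comm, ← hrm, pow_orderOf_eq_one])
    rw [map_pow] at h1
    exact hm (hs ▸ orderOf_dvd_of_pow_eq_one h1)
  have hne : Nontrivial W := (Subgroup.nontrivial_iff_ne_bot W).2 hW.1.ne'
  have hdvd : p ∣ Nat.card W := by
    obtain ⟨k, hk⟩ := IsPGroup.iff_card.1 hWp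
    rw [hk]
    refine dvd_pow_self p fun h => ?_
    rw [h, pow_zero] at hk
    exact (Finite.one_lt_card (α := W)).ne' hk
  -- A `p`-group acting on the nontrivial `p`-group `W` fixes a nontrivial element. The fixed points
  -- form a normal subgroup of `G`, hence all of `W`.
  obtain ⟨b, hb, hb1⟩ := hS.exists_fixed_point_of_prime_dvd_card_of_fixed_point W hdvd
    (a := 1) (fun s => map_one (s : MulAut W))
  let C : Subgroup G := W ⊓ Subgroup.centralizer (R : Set G)
  have hbC : (b : G) ∈ C := by
    refine ⟨b.2, Subgroup.mem_centralizer_iff.2 fun r hr => ?_⟩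
    have h1 : φ r b = b := hb ⟨φ r, r, hr, rfl⟩
    have h2 := congrArg Subtype.val h1
    rw [MulAut.conjNormal_apply] at h2
    exact mul_inv_eq_iff_eq_mul.1 h2
  rcases hW.2 C inferInstance bot_le inf_le_left with h | h
  · rw [h, Subgroup.mem_bot] at hbC
    exact absurd (Subtype.ext hbC.symm) hb1
  · intro r hr
    rw [MonoidHom.mem_ker]
    ext w
    have h1 : (w : G) ∈ C := by rw [h]; exact w.2
    have h2 := Subgroup.mem_centralizer_iff.1 h1.2 r hr
    simp [h2]

end FrattiniFactor

/-! ### Soluble saturation of `Jcs` -/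

namespace GroupClass

variable {J F : GroupClass.{u}}

theorem IsFormation.of_central (hF : F.IsFormation) {V G : Type u} [Group V] [Group G]
    {φ : G →* MulAut V} (h : F.Central φ) : F φ.range :=
  hF.image _ _ rightHom rightHom_surjective h

theorem ContainsNilpotent.of_comm (hN : F.ContainsNilpotent) {V : Type u} [Group V] [Finite V]
    (h : ∀ a b : V, a * b = b * a) : F V := by
  let _ : CommGroup V := { mul_comm := h }
  exact hN V inferInstance

section

variable {G : Type u} [Group G] [Finite G] {p : ℕ} {N W : Subgroup G} [N.Normal] [W.Normal]

/-- With `R` the common centralizer of the `p`-chief factors between `W` and `N`, the quotient `G/R`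
is in `F` as a residual product. These factors are jointly faithful modules for it, and `W` is an
irreducible one. -/
theorem SolublySaturated.central_of_no_coprime_normal (hF : F.IsFormation)
    (hN : F.ContainsNilpotent) (hS : F.SolublySaturated) (hp : p.Prime) (hNs : Group.IsSolvable N)
    (hWN : W ≤ N) (hW : IsChiefFactor W ⊥) (hWc : ∀ a b : W, a * b = b * a)
    (hWp : ∀ w : W, w ^ p = 1) (hΦ : ∀ M : Subgroup G, N ≤ W ⊔ M → N ≤ M)
    (hO : ∀ q : ℕ, q.Prime → q ≠ p → ∀ Q : Subgroup G, Q.Normal → Q ≤ N → IsPGroup q Q → Q = ⊥)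
    (hc : ∀ (H K : Subgroup G) [H.Normal] [K.Normal], IsChiefFactor H K → W ≤ K → H ≤ N →
      F.Central (factorConj H K)) :
    F.Central (MulAut.conjNormal : G →* MulAut W) := by
  have hpf : Fact p.Prime := ⟨hp⟩
  let ι := {x : Subgroup G × Subgroup G // x.1.Normal ∧ x.2.Normal ∧ IsChiefFactor x.1 x.2 ∧
    W ≤ x.2 ∧ x.1 ≤ N ∧ ∀ h ∈ x.1, h ^ p ∈ x.2}
  have hn₁ : ∀ i : ι, i.1.1.Normal := fun i => i.2.1
  have hn₂ : ∀ i : ι, i.1.2.Normal := fun i => i.2.2.1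
  let R : Subgroup G := ⨅ i : ι, factorCentralizer i.1.1 i.1.2
  have hRn : R.Normal := Subgroup.normal_iInf_normal fun i => inferInstance
  have hRle : ∀ i : ι, R ≤ (factorConj i.1.1 i.1.2).ker := fun i => iInf_le _ i
  have hR : ∀ H K : Subgroup G, H.Normal → K.Normal → IsChiefFactor H K → W ≤ K → H ≤ N →
      (∀ h ∈ H, h ^ p ∈ K) → ∀ r ∈ R, ∀ h ∈ H, r * h * r⁻¹ * h⁻¹ ∈ K :=
    fun H K hH hK hc hWK hHN hpow r hr =>
      mem_factorCentralizer.1 (hRle ⟨(H, K), hH, hK, hc, hWK, hHN, hpow⟩ hr)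
  have hWR : W ≤ R := by
    refine le_iInf fun i r hr => mem_factorCentralizer.2 fun h _ => i.2.2.2.2.1 ?_
    have h1 : r * h * r⁻¹ * h⁻¹ = r * (h * r⁻¹ * h⁻¹) := by group
    rw [h1]
    exact W.mul_mem hr (Subgroup.Normal.conj_mem inferInstance _ (W.inv_mem hr) h)
  have hWpg : IsPGroup p W := fun w => ⟨1, by rw [pow_one]; exact hWp w⟩
  have hRW := centralizes_frattini_factor hp hNs hWN hW hWR hWpg hΦ hO hR
  have hci : ∀ i : ι, F.Central (factorConj i.1.1 i.1.2) :=
    fun i => hc i.1.1 i.1.2 i.2.2.2.1 i.2.2.2.2.1 i.2.2.2.2.2.1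
  let B := G ⧸ R
  let φ : ∀ i : ι, B →* MulAut (Factor i.1.1 i.1.2) := fun i =>
    QuotientGroup.lift R (factorConj i.1.1 i.1.2) (hRle i)
  have hφr : ∀ (i : ι) (b : B), φ i b ∈ (factorConj i.1.1 i.1.2).range := by
    intro i b
    induction b using QuotientGroup.induction_on with
    | H g => exact ⟨g, rfl⟩
  let q : ∀ i : ι, B →* (factorConj i.1.1 i.1.2).range := fun i => (φ i).codRestrict _ (hφr i)
  have hq : ∀ i, Function.Surjective (q i) := by
    rintro i ⟨_, g, rfl⟩
    exact ⟨(g : G ⧸ R), rfl⟩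
  have hφ1 : ∀ b : B, (∀ i, φ i b = 1) → b = 1 := by
    intro b hb
    induction b using QuotientGroup.induction_on with
    | H g => exact (QuotientGroup.eq_one_iff g).2 (Subgroup.mem_iInf.2 fun i => hb i)
  have hB : F B := hF.of_family hN _ q hq (fun i => hF.of_central (hci i)) fun b hb =>
    hφ1 b fun i => congrArg Subtype.val (hb i)
  -- Centrality only concerns the image of `B`; the projection to `B` supplies the second subdirect
  -- factor.
  have hFi : ∀ i : ι, F (Factor i.1.1 i.1.2 ⋊[φ i] B) := by
    intro i
    have : Finite (Factor i.1.1 i.1.2 ⋊[φ i] B) := SemidirectProduct.finite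
    refine hF.of_pair (mapPair (ψ := (factorConj i.1.1 i.1.2).range.subtype) (MonoidHom.id _) (q i)
      fun _ _ => rfl) rightHom (mapPair_surjective _ Function.surjective_id (hq i))
      rightHom_surjective (hci i) hB ?_
    intro x h1 h2
    have h3 : x.left = 1 := congrArg SemidirectProduct.left h1
    exact SemidirectProduct.ext h3 h2
  let ψ : B →* MulAut W := QuotientGroup.lift R MulAut.conjNormal hRW
  let _ : CommGroup W := { mul_comm := hWc }
  have hnt : Nontrivial W := (Subgroup.nontrivial_iff_ne_bot W).2 hW.1.ne'
  have key : F (W ⋊[ψ] B) := by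
    refine semidirect_of_irreducible hF hN hS hB (fun b hb => ?_) hWp fun A hA => ?_
    · obtain ⟨i, hi⟩ : ∃ i, φ i b ≠ 1 := by
        by_contra! h
        exact hb (hφ1 b h)
      obtain ⟨hcomm, -⟩ := i.2.2.2.1.elementary_of_isSolvable (isSolvable_of_le hNs i.2.2.2.2.2.1)
      refine ⟨Factor i.1.1 i.1.2, { mul_comm := hcomm }, φ i, fun v => ?_, hFi i, hi⟩
      induction v using QuotientGroup.induction_on with
      | H h =>
        exact (factor_mk_eq_one (h ^ p)).2 (i.2.2.2.2.2.2 h h.2)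
    · have hAn : (A.map W.subtype).Normal := by
        constructor
        rintro _ ⟨a, ha, rfl⟩ g
        exact ⟨_, hA (g : G ⧸ R) a ha, MulAut.conjNormal_apply g a⟩
      rcases hW.2 _ hAn bot_le (Subgroup.map_subtype_le _) with h | h
      · exact Or.inl ((Subgroup.map_eq_bot_iff_of_injective _ W.subtype_injective).1 h)
      · right
        rw [eq_top_iff]
        intro w _
        obtain ⟨a, ha, haw⟩ : (w : G) ∈ A.map W.subtype := by rw [h]; exact w.2
        have : a = w := Subtype.ext haw
        exact this ▸ ha
  refine hF.central_transfer (φ := ψ) (MonoidHom.id W) Function.surjective_id (fun b => ?_)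
    (fun g => ⟨(g : G ⧸ R), fun _ => rfl⟩) (hF.central_of_semidirect key)
  obtain ⟨g, rfl⟩ := QuotientGroup.mk_surjective b
  exact ⟨g, fun _ => rfl⟩

end

/-- A nontrivial normal `q`-subgroup `Q ≤ N` with `q ≠ p` meets `W` trivially, so `W` is operator
isomorphic to its image in `G/Q`, where induction applies. Stating `W ≤ Φ(N)` as non-generation lets
the condition pass to the quotient. -/
theorem SolublySaturated.central_of_le_frattini (hF : F.IsFormation) (hN : F.ContainsNilpotent)
    (hS : F.SolublySaturated) : ∀ (n : ℕ) (G : Type u) [Group G] [Finite G] (N W : Subgroup G)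
    [N.Normal] [W.Normal], Nat.card G = n → Group.IsSolvable N → W ≤ N → IsChiefFactor W ⊥ →
    (∀ M : Subgroup G, N ≤ W ⊔ M → N ≤ M) →
    (∀ (H K : Subgroup G) [H.Normal] [K.Normal], IsChiefFactor H K → W ≤ K → H ≤ N →
      F.Central (factorConj H K)) →
    F.Central (MulAut.conjNormal : G →* MulAut W) := by
  intro n
  induction n using Nat.strong_induction_on with
  | _ n ih =>
  intro G _ _ N W _ _ hn hNs hWN hW hΦ hc
  obtain ⟨hcomm, p, hp, hexp⟩ := hW.elementary_of_isSolvable (isSolvable_of_le hNs hWN)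
  obtain ⟨e, -⟩ := exists_factor_bot_equiv W
  have hWc : ∀ a b : W, a * b = b * a := fun a b => e.injective (by
    rw [map_mul, map_mul, hcomm])
  have hWp : ∀ w : W, w ^ p = 1 := fun w => e.injective (by rw [map_pow, hexp, map_one])
  by_cases hO : ∀ q : ℕ, q.Prime → q ≠ p → ∀ Q : Subgroup G, Q.Normal → Q ≤ N →
      IsPGroup q Q → Q = ⊥
  · exact hS.central_of_no_coprime_normal hF hN hp hNs hWN hW hWc hWp hΦ hO hc
  push Not at hO
  obtain ⟨q, hq, hqp, Q, hQn, hQN, hQ, hQbot⟩ := hO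
  have hWpg : IsPGroup p W := fun w => ⟨1, by rw [pow_one]; exact hWp w⟩
  have hdisj : W ⊓ Q = ⊥ := by
    rw [eq_bot_iff]
    rintro x ⟨hx, hx'⟩
    exact hWpg.disjoint_of_ne_prime hp hq hqp hQ hx hx'
  let π := QuotientGroup.mk' Q
  have hπ : Function.Surjective π := QuotientGroup.mk'_surjective Q
  have hker : π.ker = Q := QuotientGroup.ker_mk' Q
  have hcomap : ∀ L : Subgroup G, (L.map π).comap π = L ⊔ Q := by
    intro L
    rw [Subgroup.comap_map_eq, hker]
  have hNn : (N.map π).Normal := Subgroup.Normal.map inferInstance _ hπ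
  have hWn : (W.map π).Normal := Subgroup.Normal.map inferInstance _ hπ
  have hNQ : (N.map π).comap π = N := by rw [hcomap, sup_eq_left.2 hQN]
  have hNs' : Group.IsSolvable (N.map π) :=
    Group.isSolvable_of_surjective (π.subgroupMap_surjective N)
  have hW' : IsChiefFactor (W.map π) ⊥ := by
    refine IsChiefFactor.of_comap hπ ?_
    rw [hcomap, MonoidHom.comap_bot, hker]
    exact hW.perspective_up rfl hdisj
  have hΦ' : ∀ M : Subgroup (G ⧸ Q), N.map π ≤ W.map π ⊔ M → N.map π ≤ M := by
    intro M hM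
    rw [Subgroup.map_le_iff_le_comap] at hM ⊢
    refine hΦ _ (hM.trans ?_)
    rw [← Subgroup.comap_sup_eq _ _ _ hπ, hcomap, sup_assoc]
    refine sup_le_sup_left (sup_le ?_ le_rfl) _
    exact hker.symm.le.trans (Subgroup.ker_le_comap _ _)
  have hc' : ∀ (H K : Subgroup (G ⧸ Q)) [H.Normal] [K.Normal], IsChiefFactor H K →
      W.map π ≤ K → H ≤ N.map π → F.Central (factorConj H K) := by
    intro H K _ _ hHK hWK hHN
    have h1 := hc _ _ (hHK.comap hπ) (Subgroup.map_le_iff_le_comap.1 hWK)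
      ((Subgroup.comap_mono hHN).trans hNQ.le)
    obtain ⟨e, he⟩ := exists_factor_equiv_comap hπ H K
    refine hF.central_transfer e.toMonoidHom e.surjective (fun g => ⟨π g, he g⟩) (fun g' => ?_) h1
    obtain ⟨g, rfl⟩ := hπ g'
    exact ⟨g, he g⟩
  have h2 := ih _ (hn ▸ card_quotient_lt hQbot) (G ⧸ Q) (N.map π) (W.map π) rfl hNs'
    (Subgroup.map_mono hWN) hW' hΦ' hc'
  let f : W ≃* W.map π := MulEquiv.ofBijective (π.subgroupMap W) ⟨by
    rw [injective_iff_map_eq_one]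
    intro w hw
    have h3 : (w : G) ∈ Q := (QuotientGroup.eq_one_iff _).1 (congrArg Subtype.val hw)
    have h4 : (w : G) ∈ W ⊓ Q := ⟨w.2, h3⟩
    rw [hdisj, Subgroup.mem_bot] at h4
    exact Subtype.ext h4, π.subgroupMap_surjective W⟩
  have hf : ∀ (g : G) (w : W.map π), f.symm (MulAut.conjNormal (π g) w) =
      MulAut.conjNormal g (f.symm w) := by
    intro g w
    rw [f.symm_apply_eq]
    obtain ⟨w, rfl⟩ := f.surjective w
    rw [f.symm_apply_apply]
    apply Subtype.ext
    rw [MulAut.conjNormal_apply]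
    change π g * π w * (π g)⁻¹ = π (MulAut.conjNormal g w : W)
    rw [MulAut.conjNormal_apply, map_mul, map_mul, map_inv]
  refine hF.central_transfer f.symm.toMonoidHom f.symm.surjective (fun g' => ?_)
    (fun g => ⟨π g, hf g⟩) h2
  obtain ⟨g, rfl⟩ := hπ g'
  exact ⟨g, hf g⟩

/-- Choose `W` minimal normal inside `Φ(N)`. The image of `Φ(N)` lies in the Frattini subgroup of
`NW/W`, so `G/W` is covered by induction; `W` is abelian, so it is in `F` and only its centrality is
at stake. -/
theorem Jcs.solublySaturated (hJ : J.IsNonabelianSimple) (hF : F.IsFormation)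
    (hN : F.ContainsNilpotent) (hS : F.SolublySaturated) : (Jcs J F).SolublySaturated := by
  have key : ∀ n : ℕ, ∀ (G : Type u) [Group G] [Finite G] (N : Subgroup G) [N.Normal],
      Nat.card G = n → Group.IsSolvable N → Jcs J F (G ⧸ (frattini N).map N.subtype) →
      Jcs J F G := by
    intro n
    induction n using Nat.strong_induction_on with
    | _ n ih =>
    intro G _ _ N _ hn hNs hG
    rcases eq_or_ne ((frattini N).map N.subtype) ⊥ with hbot | hne
    · exact (Jcs.isFormation hJ hF).of_equiv
        ((QuotientGroup.quotientMulEquivOfEq hbot).trans QuotientGroup.quotientBot) hG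
    obtain ⟨W, hWn, hWΦ, hW⟩ := IsChiefFactor.exists_upper (bot_lt_iff_ne_bot.2 hne)
    have hWN : W ≤ N := hWΦ.trans (Subgroup.map_subtype_le _)
    let π := QuotientGroup.mk' W
    have hπ : Function.Surjective π := QuotientGroup.mk'_surjective W
    have hNn : (N.map π).Normal := Subgroup.Normal.map inferInstance _ hπ
    have hle : (frattini N).map N.subtype ≤
        ((frattini (N.map π)).map (N.map π).subtype).comap π := by
      rintro _ ⟨x, hx, rfl⟩
      exact ⟨π.subgroupMap N x,
        frattini_le_comap_frattini_of_surjective (π.subgroupMap_surjective N) hx, rfl⟩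
    have hq : Jcs J F (G ⧸ W) := by
      refine ih _ (hn ▸ card_quotient_lt hW.1.ne') (G ⧸ W) (N.map π) rfl
        (Group.isSolvable_of_surjective (π.subgroupMap_surjective N)) ?_
      refine hG.image hJ hF (π := QuotientGroup.map _ _ π hle) fun x => ?_
      obtain ⟨y, rfl⟩ := QuotientGroup.mk_surjective x
      obtain ⟨g, rfl⟩ := hπ y
      exact ⟨(g : G ⧸ _), rfl⟩
    have hcomm := (hW.elementary_of_isSolvable (isSolvable_of_le hNs hWN)).1
    obtain ⟨e, -⟩ := exists_factor_bot_equiv W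
    have hFW : F W := hN.of_comm fun a b => e.injective (by rw [map_mul, map_mul, hcomm])
    refine Jcs.of_minimal hJ hF hπ hq hW (QuotientGroup.ker_mk' W)
      ⟨fun _ => ?_, fun h => absurd hFW h⟩
    refine hS.central_of_le_frattini hF hN _ G N W rfl hNs hWN hW (fun M hM => ?_) ?_
    -- Elements of the Frattini subgroup are non-generators of `N`, so `W` can be dropped from `N ≤
    -- W ⊔ M`.
    · have htop : M.subgroupOf N ⊔ frattini N = ⊤ := by
        rw [eq_top_iff]
        intro x _
        obtain ⟨w, hw, m, hm, hwm⟩ := Subgroup.mem_sup_of_normal_left.1 (hM x.2)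
        obtain ⟨y, hy, rfl⟩ := hWΦ hw
        have h1 : (⟨m, (N.mul_mem_cancel_left y.2).1 (hwm ▸ x.2)⟩ : N) ∈ M.subgroupOf N := hm
        have h2 : x = y * ⟨m, (N.mul_mem_cancel_left y.2).1 (hwm ▸ x.2)⟩ :=
          Subtype.ext hwm.symm
        rw [h2, sup_comm]
        exact Subgroup.mul_mem_sup hy h1
      exact Subgroup.subgroupOf_eq_top.1 (frattini_nongenerating htop)
    · intro H K _ _ hc hWK hHN
      refine (hq.good_of_ker_le hJ hF hπ ((QuotientGroup.ker_mk' W).le.trans hWK) hc).1 ?_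
      exact hN.of_comm (hc.elementary_of_isSolvable (isSolvable_of_le hNs hHN)).1
  exact fun G _ _ N _ hNs hG => key _ G N rfl hNs hG

end GroupClass

theorem theorem1 (J F : GroupClass.{u}) (hJ : J.IsNonabelianSimple)
    (hF : F.IsFormation) (hN : F.ContainsNilpotent) :
    (F.SolublySaturated →
      (GroupClass.Jcs J F).IsFormation ∧ (GroupClass.Jcs J F).SolublySaturated) ∧
    (F.NormallyHereditary →
      (GroupClass.Jcs J F).IsFormation ∧ (GroupClass.Jcs J F).NormallyHereditary) ∧
    (F.Fitting →
      (GroupClass.Jcs J F).IsFormation ∧ (GroupClass.Jcs J F).Fitting) :=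
  have h := GroupClass.Jcs.isFormation hJ hF
  ⟨fun hS => ⟨h, GroupClass.Jcs.solublySaturated hJ hF hN hS⟩,
    fun hh => ⟨h, GroupClass.Jcs.normallyHereditary hJ hF hh⟩,
    fun hf => ⟨h, GroupClass.Jcs.fitting hJ hF hN hf⟩⟩
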